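/- Let $\overline{\mathbb D}\subset\mathbb C$ be the closed unit disc, $\mathbb D$ its interior, $\omega_{FS}$ the Fubini–Study form on $\mathbb P^1$, given by $\omega_{FS}=dd^c\log(1+|\zeta|^2)$ in each of the coordinates $\zeta=z$ and $\zeta=w=1/z$, and $\pi:\mathbb P^1\times\overline{\mathbb D}\to\mathbb P^1$ the projection. For a smooth family $(\phi_\tau)_{\tau\in\partial\mathbb D}$ of Kähler potentials (the function $(x,\tau)\mapsto\phi_\tau(x)$ is smooth on $\mathbb P^1\times\partial\mathbb D$ and $\omega_{FS}+dd^c\phi_\tau>0$ for each $\tau$), the weak solution $\Phi$ of the Dirichlet problem for the homogeneous complex Monge–Ampère equation (HMAE) $$\Phi(\cdot,\tau)=\phi_\tau\ \ (\tau\in\partial\mathbb D),\qquad \pi^*\omega_{FS}+dd^c\Phi\ge 0,\qquad (\pi^*\omega_{FS}+dd^c\Phi)^2=0$$ is the upper envelope of all upper semicontinuous $\psi:\mathbb P^1\times\overline{\mathbb D}\to\mathbb R\cup\{-\infty\}$ such that $\pi^*\omega_{FS}+dd^c\psi\ge 0$ on $\mathbb P^1\times\mathbb D$ and $\psi(\cdot,\tau)\le\phi_\tau$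 for all $\tau\in\partial\mathbb D$. **Theorem.** There exists a smooth family of Kähler potentials $(\phi_\tau)_{\tau\in\partial\mathbb D}$ on $(\mathbb P^1,\omega_{FS})$ such that the weak solution $\Phi$ of the HMAE with this boundary data (a real-valued upper semicontinuous function on $\mathbb P^1\times\overline{\mathbb D}$ that satisfies $\pi^*\omega_{FS}+dd^c\Phi\ge0$ on $\mathbb P^1\times\mathbb D$ and takes the boundary values $\phi_\tau$) is completely degenerate on some non-empty open subset $S\subset\mathbb P^1\times\mathbb D$, i.e. $$\pi^*\omega_{FS}+dd^c\Phi\,|_S=0 \quad\text{as a current.}$$ Moreover $\Phi$ does not have maximal rank, i.e. it is not true that for every $\tau\in\overline{\mathbb D}$ the current $\omega_{FS}+dd^c\Phi(\cdot,\tau)$ on $\mathbb P^1$ is strictly positive (bounded below by $\varepsilon\,\omega_{FS}$ for some $\varepsilon>0$); and $\pi^*\omega_{FS}+dd^c\Phi$ is not identically zero on $\mathbb P^1\times\mathbb D$, so that it does not have constant rank either. -/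

import Mathlib

open scoped ContDiff Topology

noncomputable section

namespace HMAE

/-- The complex projective line, as the Riemann sphere `ℂ ∪ {∞}` with its usual topology. -/
abbrev P1 : Type := OnePoint ℂ

/-- The affine coordinate `z`. -/
def chartZ (z : ℂ) : P1 := (z : OnePoint ℂ)

/-- The affine coordinate `w = 1 / z`; the point `w = 0` is `z = ∞`. -/
def chartW (w : ℂ) : P1 := if w = 0 then OnePoint.infty else ((w⁻¹ : ℂ) : OnePoint ℂ)

/-- The standard cover of `P1` by two copies of `ℂ`. -/
def charts : Set (ℂ → P1) := {chartZ, chartW}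

/-- The local potential `log (1 + |ζ|²)` of the Fubini-Study form; it has the same expression in
both coordinates, and `ω_FS = dd^c log (1 + |ζ|²)`. -/
def fsPotential (ζ : ℂ) : ℝ := Real.log (1 + ‖ζ‖ ^ 2)

/-- Kähler potentials on `(P1, ω_FS)`: smooth real functions `f` with `ω_FS + dd^c f > 0`. In each
coordinate, `ω_FS + dd^c f` is a positive constant times the Laplacian of the local potential
`log (1 + |ζ|²) + f`. -/
def IsKahlerPotential (f : P1 → ℝ) : Prop :=
  ∀ c ∈ charts, ContDiff ℝ ∞ (fun ζ : ℂ => f (c ζ)) ∧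
    ∀ ζ : ℂ, 0 < Laplacian.laplacian (fun ξ : ℂ => fsPotential ξ + f (c ξ)) ζ

/-- The function `(τ, x) ↦ φ τ x` is smooth on the product of the unit circle and `P1`. -/
def IsSmoothFamily (φ : Circle → P1 → ℝ) : Prop :=
  ∀ c ∈ charts, ContDiff ℝ ∞ (fun q : ℝ × ℂ => φ (Circle.exp q.1) (c q.2))

/-- Plurisubharmonic functions `u : U → ℝ ∪ {-∞}` on an open set `U` (for `E = ℂ`: subharmonic
functions; the constant `-∞` is allowed): `u` is upper semicontinuous, and `u a` is at most the
mean of `u` over the boundary of every closed complex disc `{a + ζ b : |ζ| ≤ 1}` in `U`.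
Since `u` is upper semicontinuous and bounded above on the boundary circle, its mean there (which
may be `-∞`) is the infimum of the means of the continuous functions `g ≥ u` on the circle. -/
def IsPlurisubharmonicOn {E : Type*} [NormedAddCommGroup E] [NormedSpace ℂ E]
    (u : E → EReal) (U : Set E) : Prop :=
  UpperSemicontinuousOn u U ∧ (∀ p ∈ U, u p ≠ ⊤) ∧
    ∀ a b : E, (∀ ζ : ℂ, ‖ζ‖ ≤ 1 → a + ζ • b ∈ U) →
      ∀ g : ℂ → ℝ, ContinuousOn g (Metric.sphere 0 1) →
        (∀ ζ ∈ Metric.sphere (0 : ℂ) 1, u (a + ζ • b) ≤ (g ζ : EReal)) →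
          u a ≤ ((Real.circleAverage g 0 1 : ℝ) : EReal)

/-- `P1 × closed unit disc`, as a subset of `P1 × ℂ`. -/
def closedProduct : Set (P1 × ℂ) := Set.univ ×ˢ Metric.closedBall 0 1

/-- `P1 × open unit disc`, as a subset of `P1 × ℂ`. -/
def openProduct : Set (P1 × ℂ) := Set.univ ×ˢ Metric.ball 0 1

/-- The candidates `ψ : P1 × closed disc → ℝ ∪ {-∞}` for the envelope: `ψ` is upper semicontinuous,
`π^* ω_FS + dd^c ψ ≥ 0` on `P1 × open disc` (the local potentials `log (1 + |ζ|²) + ψ` are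
plurisubharmonic), and `ψ (·, τ) ≤ φ_τ` for `|τ| = 1`. Only the values of `ψ` on `closedProduct`
matter. -/
structure IsCandidate (φ : Circle → P1 → ℝ) (ψ : P1 × ℂ → EReal) : Prop where
  usc : UpperSemicontinuousOn ψ closedProduct
  ne_top : ∀ p ∈ closedProduct, ψ p ≠ ⊤
  psh : ∀ c ∈ charts, IsPlurisubharmonicOn
    (fun q : ℂ × ℂ => (fsPotential q.1 : EReal) + ψ (c q.1, q.2)) (Set.univ ×ˢ Metric.ball 0 1)
  boundary_le : ∀ (τ : Circle) (x : P1), ψ (x, (τ : ℂ)) ≤ (φ τ x : EReal)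

/-- The upper envelope of all candidates. -/
def envelope (φ : Circle → P1 → ℝ) (p : P1 × ℂ) : EReal :=
  ⨆ (ψ : P1 × ℂ → EReal) (_ : IsCandidate φ ψ), ψ p

/-- The (unique) weak solution `Φ` on `P1 × closed disc` of the Dirichlet problem for the
homogeneous complex Monge-Ampère equation with boundary data `φ`: it is the upper envelope of the
candidates, it is itself a candidate (so it is upper semicontinuous and
`π^* ω_FS + dd^c Φ ≥ 0`), and it takes the boundary values `φ`. -/
structure IsWeakSolution (φ : Circle → P1 → ℝ) (Φ : P1 × ℂ → ℝ) : Prop where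
  eq_envelope : ∀ p ∈ closedProduct, (Φ p : EReal) = envelope φ p
  candidate : IsCandidate φ (fun p => (Φ p : EReal))
  boundary_eq : ∀ (τ : Circle) (x : P1), Φ (x, (τ : ℂ)) = φ τ x

/-- Up to a positive constant, `dd^c χ (b, i b)` at `p`: the Laplacian at `ζ = 0` of the
restriction of `χ` to the complex line `ζ ↦ p + ζ b`. -/
def leviForm (χ : ℂ × ℂ → ℝ) (p b : ℂ × ℂ) : ℝ :=
  Laplacian.laplacian (fun ζ : ℂ => χ (p + ζ • b)) 0

/-- The current `π^* ω_FS + dd^c Φ` vanishes on the open set `S`. In coordinates, the local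
potential `u = log (1 + |ζ|²) + Φ` is locally integrable and `dd^c u = 0` in the sense of
distributions, i.e. `∫ u · dd^c χ (b, i b) = 0` for all test functions `χ` supported in `S` and all
constant vectors `b` (by polarization these give all coefficients of the current). -/
def CurrentVanishesOn (Φ : P1 × ℂ → ℝ) (S : Set (P1 × ℂ)) : Prop :=
  ∀ c ∈ charts,
    MeasureTheory.LocallyIntegrableOn
      (fun q : ℂ × ℂ => fsPotential q.1 + Φ (c q.1, q.2)) {q | (c q.1, q.2) ∈ S} ∧
    ∀ χ : ℂ × ℂ → ℝ, ContDiff ℝ ∞ χ → HasCompactSupport χ →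
      tsupport χ ⊆ {q | (c q.1, q.2) ∈ S} →
        ∀ b : ℂ × ℂ, ∫ q : ℂ × ℂ, (fsPotential q.1 + Φ (c q.1, q.2)) * leviForm χ q b = 0

/-- The current `ω_FS + dd^c f` on `P1` is strictly positive: it is at least `ε ω_FS` for some
`ε > 0`, i.e. the local potentials of `(1 - ε) ω_FS + dd^c f` are subharmonic. -/
def IsStrictlyPositive (f : P1 → ℝ) : Prop :=
  ∃ ε : ℝ, 0 < ε ∧ ∀ c ∈ charts, IsPlurisubharmonicOn
    (fun ζ : ℂ => (((1 - ε) * fsPotential ζ + f (c ζ) : ℝ) : EReal)) Set.univ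

/-- The current `π^* ω_FS + dd^c Φ` has maximal rank (in the fibre directions): its restriction
`ω_FS + dd^c Φ(·, τ)` to every fibre is strictly positive. -/
def HasMaximalRank (Φ : P1 × ℂ → ℝ) : Prop :=
  ∀ τ ∈ Metric.closedBall (0 : ℂ) 1, IsStrictlyPositive (fun x => Φ (x, τ))

end HMAE

end

/-!
For each `τ` on the unit circle the boundary potential `φ_τ` is chosen, in the coordinate `w`, so
that the local potential `log (1 + |w|²) + φ_τ` equals a constant `a` on the segment
`{w : conj τ * w ∈ [-1, 1]}`, which rotates with `τ`. For `|e| ≤ 1 / 2` the holomorphic disc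
`τ ↦ (e + conj e * τ², τ)` has its boundary on these segments, since
`conj τ * (e + conj e * τ²) = 2 Re (e * conj τ)` for `|τ| = 1`. By the mean value inequality the
local potential of every candidate, hence of the envelope `Φ`, is at most `a` along these discs, and
they sweep out an open set. A rotation-invariant candidate shows that the local potential of `Φ` is
at least `a` everywhere, and larger than `a` for large `|w|`. So it is equal to `a` on the open set
and the current vanishes there, but not on all of `P1 × 𝔻`: a nonconstant function with minimum `a`
attained on an open set is not pluriharmonic.
-/

namespace HMAE

open Filter MeasureTheory Metric
open scoped Laplacian

section SecondDerivative

variable {E F : Type*} [NormedAddCommGroup E] [NormedSpace ℝ E] [NormedAddCommGroup F]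
  [NormedSpace ℝ F]

theorem differentiableAt_fderiv {f : E → F} {x : E} (hf : ContDiffAt ℝ 2 f x) :
    DifferentiableAt ℝ (fderiv ℝ f) x :=
  (hf.fderiv_right (m := 1) (by norm_num)).differentiableAt (by simp)

theorem fderiv_fderiv_apply {f : E → F} {x : E} (hf : ContDiffAt ℝ 2 f x) (v w : E) :
    fderiv ℝ (fun y => fderiv ℝ f y w) x v = fderiv ℝ (fderiv ℝ f) x v w := by
  rw [fderiv_clm_apply (differentiableAt_fderiv hf) (differentiableAt_const w)]
  simp

theorem contDiff_fderiv_apply {f : E → F} (hf : ContDiff ℝ 2 f) (v : E) :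
    ContDiff ℝ 1 fun x => fderiv ℝ f x v :=
  (hf.fderiv_right (m := 1) (by norm_num)).clm_apply contDiff_const

theorem fderiv_fderiv_comp {g : F → ℝ} {f : E → F} {x : E} (hg : ContDiffAt ℝ 2 g (f x))
    (hf : ContDiffAt ℝ 2 f x) (v w : E) :
    fderiv ℝ (fderiv ℝ (g ∘ f)) x v w =
      fderiv ℝ (fderiv ℝ g) (f x) (fderiv ℝ f x v) (fderiv ℝ f x w)
        + fderiv ℝ g (f x) (fderiv ℝ (fderiv ℝ f) x v w) := by
  have hchain : fderiv ℝ (g ∘ f) =ᶠ[𝓝 x] fun y => (fderiv ℝ g (f y)).comp (fderiv ℝ f y) := by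
    filter_upwards [hf.continuousAt.eventually (hg.eventually (by simp)), hf.eventually (by simp)]
      with y hgy hfy
    exact fderiv_comp y (hgy.differentiableAt (by simp)) (hfy.differentiableAt (by simp))
  have h := ((differentiableAt_fderiv hg).hasFDerivAt.comp x
    (hf.differentiableAt (by simp)).hasFDerivAt).clm_comp (differentiableAt_fderiv hf).hasFDerivAt
  rw [(h.congr_of_eventuallyEq hchain).fderiv]
  simp [add_comm]

end SecondDerivative

theorem laplacian_eq_fderiv (g : ℂ → ℝ) (x : ℂ) :
    Δ g x = fderiv ℝ (fderiv ℝ g) x 1 1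
      + fderiv ℝ (fderiv ℝ g) x Complex.I Complex.I := by
  rw [InnerProductSpace.laplacian_eq_iteratedFDeriv_complexPlane]
  simp [iteratedFDeriv_two_apply]

theorem laplacian_comp_real {f : ℝ → ℝ} {u : ℂ → ℝ} {z : ℂ} (hf : ContDiffAt ℝ 2 f (u z))
    (hu : ContDiffAt ℝ 2 u z) :
    Δ (f ∘ u) z =
      deriv (deriv f) (u z) * (fderiv ℝ u z 1 ^ 2 + fderiv ℝ u z Complex.I ^ 2)
        + deriv f (u z) * Δ u z := by
  have hD (s : ℝ) : fderiv ℝ f (u z) s = s * deriv f (u z) := by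
    rw [fderiv_eq_smul_deriv, smul_eq_mul]
  have hD₂ (s t : ℝ) : fderiv ℝ (fderiv ℝ f) (u z) s t = s * t * deriv (deriv f) (u z) := by
    have h : deriv (deriv f) (u z) = fderiv ℝ (fderiv ℝ f) (u z) 1 1 := by
      rw [← fderiv_fderiv_apply hf, fderiv_apply_one_eq_deriv]
      simp only [fderiv_apply_one_eq_deriv]
    have hs : fderiv ℝ (fderiv ℝ f) (u z) s = s • fderiv ℝ (fderiv ℝ f) (u z) 1 := by
      rw [← map_smul, smul_eq_mul, mul_one]
    rw [h, hs, smul_apply, ← mul_one t, ← smul_eq_mul t, map_smul, smul_eq_mul, smul_eq_mul]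
    ring
  simp only [laplacian_eq_fderiv, fderiv_fderiv_comp hf hu, hD, hD₂]
  ring

theorem laplacian_comp_norm_sq {f : ℝ → ℝ} {z : ℂ} (hf : ContDiffAt ℝ 2 f (‖z‖ ^ 2)) :
    Δ (fun w : ℂ => f (‖w‖ ^ 2)) z =
      4 * (deriv f (‖z‖ ^ 2) + ‖z‖ ^ 2 * deriv (deriv f) (‖z‖ ^ 2)) := by
  have hD : fderiv ℝ (fun w : ℂ => ‖w‖ ^ 2) = fun w => 2 • innerSL ℝ w :=
    funext fun w => (hasStrictFDerivAt_norm_sq w).hasFDerivAt.fderiv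
  have hD₂ (v : ℂ) : fderiv ℝ (fun w : ℂ => 2 • innerSL ℝ w) z v v = 2 * ‖v‖ ^ 2 := by
    have h : HasFDerivAt (fun w : ℂ => 2 • innerSL ℝ w) _ z :=
      (innerSL ℝ (E := ℂ)).hasFDerivAt.const_smul (2 : ℕ)
    rw [h.fderiv, ← real_inner_self_eq_norm_sq, two_mul, two_nsmul]
    rfl
  have hnorm : ‖z‖ ^ 2 = z.re ^ 2 + z.im ^ 2 := by
    rw [← Complex.normSq_eq_norm_sq, Complex.normSq_apply, sq, sq]
  have h := laplacian_comp_real (u := fun w : ℂ => ‖w‖ ^ 2) hf (contDiff_norm_sq ℝ).contDiffAt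
  rw [Function.comp_def] at h
  rw [h, laplacian_eq_fderiv, hD, hD₂, hD₂, smul_apply, smul_apply, innerSL_apply_apply,
    innerSL_apply_apply, hnorm]
  simp only [Complex.inner, Complex.mul_re, Complex.conj_re, Complex.conj_im, Complex.one_re,
    Complex.one_im, Complex.I_re, Complex.I_im, norm_one, Complex.norm_I, nsmul_eq_mul,
    Nat.cast_ofNat]
  ring

theorem contDiffAt_real_of_analyticAt {f : ℂ → ℂ} {z : ℂ} (hf : AnalyticAt ℂ f z)
    {n : WithTop ℕ∞} : ContDiffAt ℝ n f z :=
  (hf.contDiffAt (n := n)).restrict_scalars ℝ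

theorem laplacian_comp_analytic {g : ℂ → ℝ} {f : ℂ → ℂ} {z : ℂ} (hf : AnalyticAt ℂ f z)
    (hg : ContDiffAt ℝ 2 g (f z)) :
    Δ (g ∘ f) z = ‖deriv f z‖ ^ 2 * Δ g (f z) := by
  have hD {k : ℂ → ℂ} {w : ℂ} (hk : DifferentiableAt ℂ k w) (v : ℂ) :
      fderiv ℝ k w v = v * deriv k w := by
    rw [hk.fderiv_restrictScalars ℝ, ContinuousLinearMap.coe_restrictScalars',
      fderiv_eq_smul_deriv, smul_eq_mul]
  have hD₂ (v : ℂ) : fderiv ℝ (fderiv ℝ f) z v v = v * v * deriv (deriv f) z := by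
    have h : (fun w => fderiv ℝ f w v) =ᶠ[𝓝 z] fun w => v * deriv f w :=
      hf.eventually_analyticAt.mono fun w hw => hD hw.differentiableAt v
    rw [← fderiv_fderiv_apply (contDiffAt_real_of_analyticAt hf), h.fderiv_eq,
      hD (hf.deriv.differentiableAt.const_mul v), deriv_const_mul v hf.deriv.differentiableAt,
      mul_assoc]
  simp only [laplacian_eq_fderiv, fderiv_fderiv_comp hg (contDiffAt_real_of_analyticAt hf), hD₂,
    hD hf.differentiableAt]
  set a := deriv f z
  have h1 : (1 : ℂ) * a = a.re • (1 : ℂ) + a.im • Complex.I := by simp [Complex.re_add_im]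
  have hI : Complex.I * a = (-a.im) • (1 : ℂ) + a.re • Complex.I := by
    apply Complex.ext <;> simp
  rw [h1, hI, ← Complex.normSq_eq_norm_sq, Complex.normSq_apply]
  simp only [map_add, map_smul, add_apply, smul_apply, smul_eq_mul, Complex.I_mul_I, one_mul,
    neg_mul, map_neg]
  ring

theorem laplacian_log_add_norm_sq {δ : ℝ} (hδ : 0 < δ) (z : ℂ) :
    Δ (fun w : ℂ => Real.log (δ + ‖w‖ ^ 2)) z = 4 * δ / (δ + ‖z‖ ^ 2) ^ 2 := by
  have hpos : 0 < δ + ‖z‖ ^ 2 := by positivity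
  have hD : ∀ᶠ s in 𝓝 (‖z‖ ^ 2), deriv (fun s => Real.log (δ + s)) s = (δ + s)⁻¹ := by
    have h : ∀ᶠ s in 𝓝 (‖z‖ ^ 2), 0 < δ + s :=
      continuousAt_const.eventually_lt (by fun_prop) hpos
    filter_upwards [h] with s hs
    simpa using (((hasDerivAt_id s).const_add δ).log hs.ne').deriv
  have hD₂ : HasDerivAt (fun s => (δ + s)⁻¹) (-1 / (δ + ‖z‖ ^ 2) ^ 2) (‖z‖ ^ 2) :=
    ((hasDerivAt_id _).const_add δ).inv hpos.ne'
  rw [laplacian_comp_norm_sq (f := fun s => Real.log (δ + s))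
    ((contDiffAt_const.add contDiffAt_id).log hpos.ne'), EventuallyEq.deriv_eq hD, hD₂.deriv,
    Eventually.self_of_nhds hD]
  field_simp
  ring

section VerticalIntegral

variable {k : ℂ → ℝ} {T : ℝ}

theorem hasDerivAt_integral_vertical (hk : ContDiff ℝ 1 k) (s : ℝ) :
    HasDerivAt (fun s : ℝ => ∫ θ in (0 : ℝ)..T, k (s + θ * Complex.I))
      (∫ θ in (0 : ℝ)..T, fderiv ℝ k (s + θ * Complex.I) 1) s := by
  have hk' : Continuous fun z => fderiv ℝ k z 1 :=
    (hk.continuous_fderiv one_ne_zero).clm_apply continuous_const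
  have hline (t : ℝ) : Continuous fun θ : ℝ => (t + θ * Complex.I : ℂ) := by fun_prop
  obtain ⟨C, hC⟩ := ((isCompact_closedBall s 1).prod
    (isCompact_uIcc (a := (0 : ℝ)) (b := T))).exists_bound_of_continuousOn
    (f := fun p : ℝ × ℝ => fderiv ℝ k (p.1 + p.2 * Complex.I) 1)
    (hk'.comp (by fun_prop)).continuousOn
  have hC' : IntervalIntegrable (fun _ => C) volume 0 T := intervalIntegrable_const
  refine (intervalIntegral.hasDerivAt_integral_of_dominated_loc_of_deriv_le
    (𝕜 := ℝ) (x₀ := s) (F' := fun t θ => fderiv ℝ k (t + θ * Complex.I) 1)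
    (ball_mem_nhds s one_pos)
    (.of_forall fun t => ?_) ?_ ?_ (.of_forall fun θ hθ t ht => ?_) hC'
    (.of_forall fun θ _ t _ => ?_)).2
  · exact (hk.continuous.comp (hline t)).aestronglyMeasurable
  · exact (hk.continuous.comp (hline s)).intervalIntegrable _ _
  · exact (hk'.comp (hline s)).aestronglyMeasurable
  · exact hC (t, θ) ⟨ball_subset_closedBall ht, Set.uIoc_subset_uIcc hθ⟩
  · exact (hk.differentiable one_ne_zero _).hasFDerivAt.comp_hasDerivAt t
      (Complex.ofRealCLM.hasDerivAt.add_const _)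

theorem integral_vertical_fderiv_eq_zero (hk : ContDiff ℝ 1 k)
    (hper : ∀ z, k (z + T * Complex.I) = k z) (s : ℝ) :
    ∫ θ in (0 : ℝ)..T, fderiv ℝ k (s + θ * Complex.I) Complex.I = 0 := by
  rw [intervalIntegral.integral_eq_sub_of_hasDerivAt (f := fun θ : ℝ => k (s + θ * Complex.I))]
  · simp [hper]
  · intro θ _
    refine (hk.differentiable one_ne_zero _).hasFDerivAt.comp_hasDerivAt θ ?_
    simpa using ((Complex.ofRealCLM.hasDerivAt (x := θ)).mul_const Complex.I).const_add (s : ℂ)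
  · exact (((hk.continuous_fderiv one_ne_zero).comp (by fun_prop)).clm_apply
      continuous_const).intervalIntegrable _ _

theorem integral_vertical_fderiv_fderiv_nonneg (hk : ContDiff ℝ 2 k)
    (hΔ : ∀ z, 0 ≤ Δ k z) (hT : 0 ≤ T)
    (hper : ∀ z, k (z + T * Complex.I) = k z) (s : ℝ) :
    0 ≤ ∫ θ in (0 : ℝ)..T, fderiv ℝ (fun z => fderiv ℝ k z 1) (s + θ * Complex.I) 1 := by
  have hline : Continuous fun θ : ℝ => (s + θ * Complex.I : ℂ) := by fun_prop
  have hint (v : ℂ) : IntervalIntegrable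
      (fun θ : ℝ => fderiv ℝ (fun z => fderiv ℝ k z v) (s + θ * Complex.I) v)
      volume 0 T :=
    ((((contDiff_fderiv_apply hk v).continuous_fderiv one_ne_zero).comp hline).clm_apply
      continuous_const).intervalIntegrable _ _
  have hper' (z : ℂ) : fderiv ℝ k (z + T * Complex.I) Complex.I = fderiv ℝ k z Complex.I := by
    rw [← fderiv_comp_add_right]
    simp_rw [hper]
  have hvert := integral_vertical_fderiv_eq_zero (contDiff_fderiv_apply hk Complex.I) hper' s
  have hsum := intervalIntegral.integral_add (hint 1) (hint Complex.I)
  rw [hvert, add_zero] at hsum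
  rw [← hsum]
  refine intervalIntegral.integral_nonneg hT fun θ _ => ?_
  rw [fderiv_fderiv_apply hk.contDiffAt, fderiv_fderiv_apply hk.contDiffAt, ← laplacian_eq_fderiv]
  exact hΔ _

theorem convexOn_integral_vertical (hk : ContDiff ℝ 2 k) (hΔ : ∀ z, 0 ≤ Δ k z)
    (hT : 0 ≤ T) (hper : ∀ z, k (z + T * Complex.I) = k z) :
    ConvexOn ℝ Set.univ fun s : ℝ => ∫ θ in (0 : ℝ)..T, k (s + θ * Complex.I) := by
  have h1 := hasDerivAt_integral_vertical (T := T) (hk.of_le one_le_two)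
  have h2 := hasDerivAt_integral_vertical (T := T) (contDiff_fderiv_apply hk 1)
  have hderiv := funext fun s => (h1 s).deriv
  refine convexOn_univ_of_deriv2_nonneg (fun s => (h1 s).differentiableAt) ?_ fun s => ?_
  · rw [hderiv]
    exact fun s => (h2 s).differentiableAt
  · rw [Function.iterate_succ_apply, Function.iterate_one, hderiv, (h2 s).deriv]
    exact integral_vertical_fderiv_fderiv_nonneg hk hΔ hT hper s

end VerticalIntegral

theorem le_of_convexOn_of_tendsto_atBot {B : ℝ → ℝ} {l : ℝ} (hB : ConvexOn ℝ Set.univ B)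
    (hl : Tendsto B atBot (𝓝 l)) (x : ℝ) : l ≤ B x := by
  have hmid (t : ℝ) : B (x - t) ≤ 2⁻¹ * B x + 2⁻¹ * B (x - 2 * t) := by
    have h := hB.2 (Set.mem_univ x) (Set.mem_univ (x - 2 * t)) (by norm_num : (0 : ℝ) ≤ 2⁻¹)
      (by norm_num : (0 : ℝ) ≤ 2⁻¹) (by norm_num)
    simp only [smul_eq_mul] at h
    rwa [show 2⁻¹ * x + 2⁻¹ * (x - 2 * t) = x - t by ring] at h
  have hshift {c : ℝ} (hc : 0 < c) : Tendsto (fun t => B (x - c * t)) atTop (𝓝 l) :=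
    hl.comp (tendsto_atBot_add_const_left _ x
      (tendsto_neg_atTop_atBot.comp (tendsto_id.const_mul_atTop hc)))
  have hlim := le_of_tendsto_of_tendsto' (by simpa using hshift one_pos)
    (((hshift two_pos).const_mul 2⁻¹).const_add (2⁻¹ * B x)) hmid
  linarith

/-- Pulling back by `exp` turns circle averages into vertical integrals of a periodic function. -/
theorem le_circleAverage_of_laplacian_nonneg {g : ℂ → ℝ} (hg : ContDiff ℝ 2 g)
    (hΔ : ∀ z, 0 ≤ Δ g z) : g 0 ≤ Real.circleAverage g 0 1 := by
  have hexp (z : ℂ) : AnalyticAt ℂ Complex.exp z := Complex.differentiable_exp.analyticAt z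
  have hconv := convexOn_integral_vertical (k := g ∘ Complex.exp) (T := 2 * Real.pi)
    (hg.comp (Complex.contDiff_exp (𝕜 := ℝ)))
    (fun z => by
      rw [laplacian_comp_analytic (hexp z) hg.contDiffAt]
      exact mul_nonneg (sq_nonneg _) (hΔ _))
    (by positivity) fun z => by simp [Complex.exp_periodic z]
  have havg : (fun s : ℝ => ∫ θ in (0 : ℝ)..2 * Real.pi,
      (g ∘ Complex.exp) (s + θ * Complex.I)) =
      fun s => 2 * Real.pi * Real.circleAverage g 0 (Real.exp s) := funext fun s => by
    rw [Real.circleAverage_def, smul_eq_mul, ← mul_assoc, mul_inv_cancel₀ (by positivity), one_mul]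
    simp [circleMap, Complex.exp_add]
  have hlim : Tendsto (fun s => 2 * Real.pi * Real.circleAverage g 0 (Real.exp s))
      atBot (𝓝 (2 * Real.pi * g 0)) := by
    have h := (Real.Continuous.circleAverage (c := 0) hg.continuous).tendsto 0
    rw [Real.circleAverage_zero] at h
    exact (h.comp Real.tendsto_exp_atBot).const_mul _
  rw [havg] at hconv
  have h := le_of_convexOn_of_tendsto_atBot hconv hlim 0
  rw [Real.exp_zero] at h
  exact le_of_mul_le_mul_left h (by positivity)

section Charts

theorem chartW_zero : chartW 0 = OnePoint.infty := by simp [chartW]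

theorem chartW_of_ne {w : ℂ} (hw : w ≠ 0) : chartW w = chartZ w⁻¹ := by simp [chartW, chartZ, hw]

theorem continuous_chartZ : Continuous chartZ := OnePoint.continuous_coe

theorem continuous_chartW : Continuous chartW := by
  rw [continuous_iff_continuousAt]
  intro w
  rcases eq_or_ne w 0 with rfl | hw
  · rw [continuousAt_iff_punctured_nhds, chartW_zero]
    have h1 : Tendsto (fun w : ℂ => w⁻¹) (𝓝[≠] 0) (coclosedCompact ℂ) := by
      rw [coclosedCompact_eq_cocompact, ← cobounded_eq_cocompact]
      exact tendsto_inv₀_nhdsNE_zero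
    refine (OnePoint.tendsto_coe_infty.comp h1).congr' ?_
    filter_upwards [self_mem_nhdsWithin] with z hz
    exact (chartW_of_ne hz).symm
  · have h1 : ContinuousAt (fun w : ℂ => chartZ w⁻¹) w :=
      continuous_chartZ.continuousAt.comp (continuousAt_inv₀ hw)
    refine h1.congr ?_
    filter_upwards [isOpen_ne.mem_nhds hw] with z hz
    exact (chartW_of_ne hz).symm

/-- The inversion `z ↦ 1 / z` of the Riemann sphere; it exchanges the two coordinates. -/
noncomputable def inversion (x : P1) : P1 := OnePoint.elim x (chartZ 0) chartW

theorem inversion_coe (z : ℂ) : inversion (z : OnePoint ℂ) = chartW z := rfl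

theorem inversion_infty : inversion OnePoint.infty = chartZ 0 := rfl

theorem inversion_inversion (x : P1) : inversion (inversion x) = x := by
  induction x using OnePoint.rec with
  | infty => rw [inversion_infty, chartZ, inversion_coe, chartW_zero]
  | coe z =>
    rw [inversion_coe]
    rcases eq_or_ne z 0 with rfl | hz
    · rw [chartW_zero, inversion_infty, chartZ]
    · rw [chartW_of_ne hz, chartZ, inversion_coe, chartW_of_ne (inv_ne_zero hz), inv_inv, chartZ]

theorem continuous_inversion : Continuous inversion := by
  refine (OnePoint.continuous_iff _).2 ⟨?_, continuous_chartW⟩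
  rw [inversion_infty]
  have h1 : Tendsto (fun w : ℂ => w⁻¹) (coclosedCompact ℂ) (𝓝 0) := by
    rw [coclosedCompact_eq_cocompact, ← cobounded_eq_cocompact]
    exact tendsto_inv₀_cobounded
  refine ((continuous_chartZ.tendsto 0).comp h1).congr' ?_
  have h2 : ∀ᶠ w : ℂ in coclosedCompact ℂ, w ≠ 0 := by
    rw [coclosedCompact_eq_cocompact]
    exact isCompact_singleton.compl_mem_cocompact
  filter_upwards [h2] with z hz
  rw [inversion_coe, chartW_of_ne hz]
  rfl

theorem isOpenEmbedding_chart {c : ℂ → P1} (hc : c ∈ charts) : Topology.IsOpenEmbedding c := by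
  rcases hc with rfl | rfl
  · exact OnePoint.isOpenEmbedding_coe
  · have hinv : Function.Involutive inversion := inversion_inversion
    let e : P1 ≃ₜ P1 := ⟨hinv.toPerm, continuous_inversion, continuous_inversion⟩
    exact e.isOpenEmbedding.comp OnePoint.isOpenEmbedding_coe

theorem exists_chart_eq (x : P1) : ∃ c ∈ charts, ∃ ζ : ℂ, c ζ = x := by
  induction x using OnePoint.rec with
  | infty => exact ⟨chartW, by simp [charts], 0, chartW_zero⟩
  | coe z => exact ⟨chartZ, by simp [charts], z, rfl⟩

theorem continuous_of_charts {X : Type*} [TopologicalSpace X] {f : P1 → X}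
    (h : ∀ c ∈ charts, Continuous (f ∘ c)) : Continuous f := by
  rw [continuous_iff_continuousAt]
  intro x
  obtain ⟨c, hc, ζ, rfl⟩ := exists_chart_eq x
  exact (isOpenEmbedding_chart hc).continuousAt_iff.1 (h c hc).continuousAt

theorem nhds_chart_prod {c : ℂ → P1} (hc : c ∈ charts) (q : ℂ × ℂ) :
    𝓝 (c q.1, q.2) = map (fun p : ℂ × ℂ => (c p.1, p.2)) (𝓝 q) :=
  (((isOpenEmbedding_chart hc).prodMap Topology.IsOpenEmbedding.id).map_nhds_eq q).symm

end Charts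

theorem coe_add_le_coe_iff {r g : ℝ} {x : EReal} :
    (r : EReal) + x ≤ (g : EReal) ↔ x ≤ ((g - r : ℝ) : EReal) := by
  rw [EReal.coe_sub, EReal.le_sub_iff_add_le (.inl (EReal.coe_ne_bot r))
    (.inl (EReal.coe_ne_top r)), add_comm]

theorem upperSemicontinuousOn_coe_add {X : Type*} [TopologicalSpace X] {s : Set X}
    {f : X → EReal} {r : X → ℝ} (hf : UpperSemicontinuousOn f s) (hr : ContinuousOn r s) :
    UpperSemicontinuousOn (fun x => (r x : EReal) + f x) s := by
  refine UpperSemicontinuousOn.add' ?_ hf fun x _ => EReal.continuousAt_add (by simp) (by simp)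
  exact (continuous_coe_real_ereal.comp_continuousOn hr).upperSemicontinuousOn

theorem upperSemicontinuousOn_comp {X Y : Type*} [TopologicalSpace X] [TopologicalSpace Y]
    {f : Y → EReal} {g : X → Y} {s : Set X} {t : Set Y} (hf : UpperSemicontinuousOn f t)
    (hg : ContinuousOn g s) (hst : Set.MapsTo g s t) :
    UpperSemicontinuousOn (fun x => f (g x)) s := fun x hx y hy =>
  ((hg x hx).tendsto_nhdsWithin hst).eventually (hf (g x) (hst hx) y hy)

theorem exists_forall_le_coe {X : Type*} [TopologicalSpace X] {v : X → EReal} {K : Set X}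
    (hK : IsCompact K) (husc : UpperSemicontinuousOn v K) (htop : ∀ p ∈ K, v p ≠ ⊤) :
    ∃ M : ℝ, ∀ p ∈ K, v p ≤ M := by
  rcases K.eq_empty_or_nonempty with rfl | hne
  · exact ⟨0, by simp⟩
  · obtain ⟨p₀, hp₀, hmax⟩ := husc.exists_isMaxOn hne hK
    exact ⟨(v p₀).toReal, fun p hp => (hmax hp).trans (EReal.le_coe_toReal (htop p₀ hp₀))⟩

/-- An upper semicontinuous function with `v ≤ q` where `g = 0` is, up to `η`, below `q` penalized
by a large multiple of `g`. -/
theorem exists_forall_le_add_penalty {X : Type*} [TopologicalSpace X] {v : X → EReal} {K : Set X}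
    {q g : X → ℝ} (hK : IsCompact K) (husc : UpperSemicontinuousOn v K)
    (htop : ∀ p ∈ K, v p ≠ ⊤) (hq : ContinuousOn q K) (hg : ContinuousOn g K)
    (hg0 : ∀ p ∈ K, 0 ≤ g p) (hle : ∀ p ∈ K, g p = 0 → v p ≤ q p) {η : ℝ} (hη : 0 < η) :
    ∃ N : ℝ, 0 ≤ N ∧ ∀ p ∈ K, v p ≤ ((q p + η + N * g p : ℝ) : EReal) := by
  have hdiff : UpperSemicontinuousOn (fun p => ((-q p : ℝ) : EReal) + v p) K :=
    upperSemicontinuousOn_coe_add husc hq.neg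
  obtain ⟨M, hM⟩ := exists_forall_le_coe hK hdiff fun p hp =>
    EReal.add_ne_top (EReal.coe_ne_top _) (htop p hp)
  simp only [coe_add_le_coe_iff, sub_neg_eq_add] at hM
  set S := K ∩ (fun p => ((-q p : ℝ) : EReal) + v p) ⁻¹' Set.Ici (η : EReal)
  have hnotS {p : X} (hp : p ∈ K) (hpS : p ∉ S) : v p ≤ ((q p + η : ℝ) : EReal) := by
    have h : ((-q p : ℝ) : EReal) + v p ≤ (η : EReal) := le_of_not_ge fun h => hpS ⟨hp, h⟩
    rwa [coe_add_le_coe_iff, sub_neg_eq_add, add_comm] at h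
  rcases S.eq_empty_or_nonempty with hS | hS
  · exact ⟨0, le_rfl, fun p hp => by simpa using hnotS hp (hS ▸ Set.notMem_empty p)⟩
  have hScomp : IsCompact S := hdiff.isCompact_inter_preimage_Ici hK _
  obtain ⟨p₀, hp₀, hmin⟩ := hScomp.exists_isMinOn hS (hg.mono Set.inter_subset_left)
  have hpos : 0 < g p₀ := (hg0 p₀ hp₀.1).lt_of_ne fun h => by
    have hge : (η : EReal) ≤ _ := hp₀.2
    have hle0 := hle p₀ hp₀.1 h.symm
    have h0 : ((-q p₀ : ℝ) : EReal) + v p₀ ≤ ((0 : ℝ) : EReal) :=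
      coe_add_le_coe_iff.2 (by simpa using hle0)
    exact hη.not_ge (EReal.coe_le_coe_iff.1 (hge.trans h0))
  refine ⟨|M| / g p₀, by positivity, fun p hp => ?_⟩
  by_cases hpS : p ∈ S
  · have hgp : |M| ≤ |M| / g p₀ * g p := by
      rw [div_mul_eq_mul_div, le_div_iff₀ hpos]
      exact mul_le_mul_of_nonneg_left (hmin hpS) (abs_nonneg M)
    exact (hM p hp).trans (EReal.coe_le_coe_iff.2 (by linarith [le_abs_self M]))
  · have hnn : 0 ≤ |M| / g p₀ * g p := mul_nonneg (by positivity) (hg0 p hp)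
    exact (hnotS hp hpS).trans (EReal.coe_le_coe_iff.2 (by linarith))

section MaximumPrinciple

theorem exists_real_max {X : Type*} [TopologicalSpace X] {v : X → EReal} {K : Set X} {q : X → ℝ}
    (hK : IsCompact K) (husc : UpperSemicontinuousOn v K) (htop : ∀ p ∈ K, v p ≠ ⊤)
    (hq : ContinuousOn q K) {p : X} (hp : p ∈ K) (hlt : (q p : EReal) < v p) :
    ∃ p₀ ∈ K, ∃ m : ℝ, 0 < m ∧ v p₀ = ((q p₀ + m : ℝ) : EReal) ∧
      ∀ x ∈ K, v x ≤ ((q x + m : ℝ) : EReal) := by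
  obtain ⟨p₀, hp₀, hmax⟩ := (upperSemicontinuousOn_coe_add husc hq.neg).exists_isMaxOn ⟨p, hp⟩ hK
  have hpos : (0 : EReal) < ((-q p₀ : ℝ) : EReal) + v p₀ := by
    refine lt_of_lt_of_le (lt_of_not_ge fun h => hlt.not_ge ?_) (hmax hp)
    rw [← EReal.coe_zero, coe_add_le_coe_iff] at h
    simpa using h
  have hreal : ((-q p₀ : ℝ) : EReal) + v p₀ = ((((-q p₀ : ℝ) : EReal) + v p₀).toReal : EReal) :=
    (EReal.coe_toReal (EReal.add_ne_top (EReal.coe_ne_top _) (htop p₀ hp₀)) hpos.ne_bot).symm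
  set m := (((-q p₀ : ℝ) : EReal) + v p₀).toReal
  have hle {x : X} (hx : x ∈ K) : v x ≤ ((q x + m : ℝ) : EReal) := by
    have h : ((-q x : ℝ) : EReal) + v x ≤ m := hreal ▸ hmax hx
    rwa [coe_add_le_coe_iff, sub_neg_eq_add, add_comm] at h
  refine ⟨p₀, hp₀, m, EReal.coe_pos.1 (hreal ▸ hpos), (hle hp₀).antisymm ?_, fun x hx => hle hx⟩
  rw [EReal.coe_add, ← hreal, ← add_assoc, ← EReal.coe_add, add_neg_cancel, EReal.coe_zero,
    zero_add]

variable {E : Type*} [NormedAddCommGroup E] [NormedSpace ℂ E]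

/-- A maximum principle: a plurisubharmonic function lies below `q` on a compact set if, at each
point where this is not known, `q` violates the sub-mean value inequality on some disc. -/
theorem IsPlurisubharmonicOn.le_of_circleAverage_lt {v : E → EReal} {U K : Set E} {q : E → ℝ}
    (hv : IsPlurisubharmonicOn v U) (hK : IsCompact K) (husc : UpperSemicontinuousOn v K)
    (htop : ∀ p ∈ K, v p ≠ ⊤) (hq : ContinuousOn q K)
    (h : ∀ p ∈ K, v p ≤ (q p : EReal) ∨ ∃ b : E, (∀ ζ : ℂ, ‖ζ‖ ≤ 1 → p + ζ • b ∈ U ∩ K) ∧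
      ∃ g : ℂ → ℝ, ContinuousOn g (sphere 0 1) ∧
        (∀ ζ ∈ sphere (0 : ℂ) 1, q (p + ζ • b) ≤ g ζ) ∧ Real.circleAverage g 0 1 < q p) :
    ∀ p ∈ K, v p ≤ (q p : EReal) := by
  by_contra! hcon
  obtain ⟨p, hp, hlt⟩ := hcon
  obtain ⟨p₀, hp₀, m, hm, hvp₀, hmax⟩ := exists_real_max hK husc htop hq hp hlt
  rcases h p₀ hp₀ with hle | ⟨b, hb, g, hg, hqg, havg⟩
  · rw [hvp₀, EReal.coe_le_coe_iff] at hle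
    linarith
  · have hsub := hv.2.2 p₀ b (fun ζ hζ => (hb ζ hζ).1) (fun ζ => m + g ζ)
      (continuousOn_const.add hg) fun ζ hζ =>
        (hmax _ (hb ζ (mem_sphere_zero_iff_norm.1 hζ).le).2).trans
          (EReal.coe_le_coe_iff.2 (by linarith [hqg ζ hζ]))
    rw [Real.circleAverage_fun_add (circleIntegrable_const _ _ _)
      (ContinuousOn.circleIntegrable zero_le_one hg), Real.circleAverage_const, hvp₀,
      EReal.coe_le_coe_iff] at hsub
    linarith

theorem isPlurisubharmonicOn_of_continuousOn {u : E → ℝ} {U : Set E} (hu : ContinuousOn u U)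
    (h : ∀ a b : E, (∀ ζ : ℂ, ‖ζ‖ ≤ 1 → a + ζ • b ∈ U) →
      u a ≤ Real.circleAverage (fun ζ => u (a + ζ • b)) 0 1) :
    IsPlurisubharmonicOn (fun x => (u x : EReal)) U := by
  refine ⟨(continuous_coe_real_ereal.comp_continuousOn hu).upperSemicontinuousOn, by simp,
    fun a b hab g hg hle => EReal.coe_le_coe_iff.2 ((h a b hab).trans ?_)⟩
  refine Real.circleAverage_mono (ContinuousOn.circleIntegrable zero_le_one ?_)
    (ContinuousOn.circleIntegrable zero_le_one hg) fun ζ hζ => ?_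
  · exact hu.comp (by fun_prop) fun ζ hζ => hab ζ (mem_sphere_zero_iff_norm.1 hζ).le
  · rw [abs_one] at hζ
    exact EReal.coe_le_coe_iff.1 (hle ζ hζ)

end MaximumPrinciple

section HolomorphicGraph

theorem circleAverage_re {h : ℂ → ℂ} (hh : DiffContOnCl ℂ h (ball 0 1)) :
    Real.circleAverage (fun ζ => (h ζ).re) 0 1 = (h 0).re := by
  refine InnerProductSpace.HarmonicContOnCl.circleAverage_eq
    ⟨fun z hz => ?_, Complex.continuous_re.comp_continuousOn (by rw [abs_one]; exact hh.2)⟩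
  rw [abs_one] at hz
  exact (hh.differentiableOn.analyticAt (isOpen_ball.mem_nhds hz)).harmonicAt_re

theorem norm_add_sq_eq_re (p b : ℂ) :
    ‖p + b‖ ^ 2 = ‖p‖ ^ 2 + ‖b‖ ^ 2 + 2 * ((starRingEnd ℂ) p * b).re := by
  rw [norm_add_sq_real, Complex.inner, mul_comm b]
  ring

theorem eventually_norm_sub_tangent_le {f : ℂ → ℂ} {t : ℂ} (hf : DifferentiableAt ℂ f t) {ε : ℝ}
    (hε : 0 < ε) : ∀ᶠ r : ℝ in 𝓝[>] 0, ∀ ζ : ℂ, ‖ζ‖ ≤ 1 →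
      ‖f (t + ζ * r) - f t - ζ * r * deriv f t‖ ≤ ε * r := by
  have h := (hasDerivAt_iff_isLittleO_nhds_zero.1 hf.hasDerivAt).bound hε
  obtain ⟨δ, hδ, hball⟩ := Metric.eventually_nhds_iff.1 h
  filter_upwards [Ioo_mem_nhdsGT hδ] with r hr ζ hζ
  have hnorm : ‖ζ * r‖ ≤ r := by
    rw [norm_mul, Complex.norm_real, Real.norm_of_nonneg hr.1.le]
    exact mul_le_of_le_one_left hr.1.le hζ
  have := hball (y := ζ * r) (by simpa using hnorm.trans_lt hr.2)
  rw [smul_eq_mul] at this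
  exact this.trans (by gcongr)

/-- Passing from `0` to the circle costs `η r²` in the second summand, which outweighs the gain
`N ‖R‖²` in the third. -/
theorem exists_circleAverage_lt_of_norm_sq_le {κ R : ℂ → ℂ}
    (hκ : DiffContOnCl ℂ κ (ball 0 1)) (hR : DiffContOnCl ℂ R (ball 0 1))
    (hR0 : R 0 = 0) {η N c r : ℝ} (hN : 0 ≤ N) (hc : N * c < η) (hr : 0 < r)
    (hRc : ∀ ζ : ℂ, ‖ζ‖ = 1 → ‖R ζ‖ ^ 2 ≤ c * r ^ 2) (t d : ℂ) :
    ∃ g : ℂ → ℝ, ContinuousOn g (sphere 0 1) ∧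
      (∀ ζ ∈ sphere (0 : ℂ) 1,
        (κ ζ).re + η * (1 - ‖t + ζ * r‖ ^ 2) + N * ‖d - R ζ‖ ^ 2 ≤ g ζ) ∧
      Real.circleAverage g 0 1 < (κ 0).re + η * (1 - ‖t‖ ^ 2) + N * ‖d‖ ^ 2 := by
  set A : ℝ := η * (1 - (‖t‖ ^ 2 + r ^ 2)) + N * (‖d‖ ^ 2 + c * r ^ 2) with hA
  set h : ℂ → ℂ := fun ζ => κ ζ + A - (2 * η : ℝ) * ((starRingEnd ℂ) t * (ζ * r))
    - (2 * N : ℝ) * ((starRingEnd ℂ) d * R ζ)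
  have hlin : Differentiable ℂ fun ζ : ℂ => (2 * η : ℝ) * ((starRingEnd ℂ) t * (ζ * r)) := by
    fun_prop
  have hRlin : DiffContOnCl ℂ (fun ζ => (2 * N : ℝ) * ((starRingEnd ℂ) d * R ζ))
      (ball 0 1) := (hR.const_smul ((starRingEnd ℂ) d)).const_smul ((2 * N : ℝ) : ℂ)
  have hh : DiffContOnCl ℂ h (ball 0 1) :=
    ((hκ.add_const _).sub hlin.diffContOnCl).sub hRlin
  have hre (ζ : ℂ) : (h ζ).re = (κ ζ).re + A - 2 * η * ((starRingEnd ℂ) t * (ζ * r)).re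
      - 2 * N * ((starRingEnd ℂ) d * R ζ).re := by
    simp only [h, Complex.add_re, Complex.sub_re, Complex.ofReal_re, Complex.re_ofReal_mul]
  refine ⟨fun ζ => (h ζ).re, Complex.continuous_re.comp_continuousOn
    (hh.continuousOn_ball.mono sphere_subset_closedBall), fun ζ hζ => ?_, ?_⟩
  · have hζ1 : ‖ζ‖ = 1 := mem_sphere_zero_iff_norm.1 hζ
    simp only [hre]
    rw [hA, norm_add_sq_eq_re, sub_eq_add_neg d, norm_add_sq_eq_re, norm_mul, norm_neg, hζ1,
      Complex.norm_real, Real.norm_of_nonneg hr.le, mul_neg, Complex.neg_re]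
    linarith [mul_le_mul_of_nonneg_left (hRc ζ hζ1) hN]
  · rw [circleAverage_re hh, hre, hA, hR0]
    simp only [zero_mul, mul_zero, Complex.zero_re]
    nlinarith [mul_lt_mul_of_pos_right hc (pow_pos hr 2)]

theorem exists_disc_circleAverage_lt {f k : ℂ → ℂ} (hf : DifferentiableOn ℂ f (ball 0 1))
    (hk : DifferentiableOn ℂ k (ball 0 1)) {η N : ℝ} (hη : 0 < η) (hN : 0 ≤ N) {p : ℂ × ℂ}
    (hp2 : ‖p.2‖ < 1) (hp1 : ‖p.1 - f p.2‖ < 1) :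
    ∃ b : ℂ × ℂ, (∀ ζ : ℂ, ‖ζ‖ ≤ 1 →
        ‖(p + ζ • b).2‖ < 1 ∧ ‖(p + ζ • b).1 - f (p + ζ • b).2‖ ≤ 1) ∧
      ∃ g : ℂ → ℝ, ContinuousOn g (sphere 0 1) ∧
        (∀ ζ ∈ sphere (0 : ℂ) 1, (k (p + ζ • b).2).re + η * (1 - ‖(p + ζ • b).2‖ ^ 2)
          + N * ‖(p + ζ • b).1 - f (p + ζ • b).2‖ ^ 2 ≤ g ζ) ∧
        Real.circleAverage g 0 1 < (k p.2).re + η * (1 - ‖p.2‖ ^ 2) + N * ‖p.1 - f p.2‖ ^ 2 := by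
  obtain ⟨w, t⟩ := p
  obtain ⟨c, hc, hcN⟩ := exists_pos_mul_lt hη N
  have hsmall {a : ℝ} (ha : a < 1) (C : ℝ) : ∀ᶠ r : ℝ in 𝓝[>] 0, a + C * r < 1 :=
    (show Continuous fun r => a + C * r by fun_prop).continuousWithinAt.eventually_lt_const
      (by simpa using ha)
  obtain ⟨r, hr : 0 < r, htr, hwr, hR⟩ := (eventually_mem_nhdsWithin.and ((hsmall hp2 1).and
    ((hsmall hp1 √c).and (eventually_norm_sub_tangent_le (hf.differentiableAt
      (isOpen_ball.mem_nhds (mem_ball_zero_iff.2 hp2))) (Real.sqrt_pos.2 hc))))).exists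
  set R : ℂ → ℂ := fun ζ => f (t + ζ * r) - f t - ζ * r * deriv f t with hRdef
  have hdisc {ζ : ℂ} (hζ : ‖ζ‖ ≤ 1) : ‖t + ζ * r‖ < 1 := by
    refine (norm_add_le _ _).trans_lt (lt_of_le_of_lt ?_ htr)
    rw [norm_mul, Complex.norm_real, Real.norm_of_nonneg hr.le]
    gcongr
  have hdefect (ζ : ℂ) : w + ζ * (r * deriv f t) - f (t + ζ * r) = w - f t - R ζ := by
    simp only [hRdef]
    ring
  have hcomp {k : ℂ → ℂ} (hk : DifferentiableOn ℂ k (ball 0 1)) :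
      DifferentiableOn ℂ (fun ζ : ℂ => k (t + ζ * r)) (closedBall 0 1) :=
    hk.comp (by fun_prop) fun ζ hζ => mem_ball_zero_iff.2 (hdisc (mem_closedBall_zero_iff.1 hζ))
  have hRdiff : DifferentiableOn ℂ R (closedBall 0 1) :=
    ((hcomp hf).sub_const _).sub (by fun_prop)
  obtain ⟨g, hg, hle, havg⟩ := exists_circleAverage_lt_of_norm_sq_le
    ((hcomp hk).diffContOnCl_ball subset_rfl) (hRdiff.diffContOnCl_ball subset_rfl)
    (by simp [hRdef]) hN hcN hr (fun ζ hζ => by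
      simpa only [mul_pow, Real.sq_sqrt hc.le] using
        pow_le_pow_left₀ (norm_nonneg _) (hR ζ hζ.le) 2) t (w - f t)
  refine ⟨(r * deriv f t, r), fun ζ hζ => ⟨hdisc hζ, ?_⟩, g, hg, fun ζ hζ => ?_,
    by simpa using havg⟩
  · simp only [Prod.smul_mk, Prod.mk_add_mk, smul_eq_mul, hdefect]
    exact (norm_sub_le _ _).trans ((add_le_add le_rfl (hR ζ hζ)).trans hwr.le)
  · simpa only [Prod.smul_mk, Prod.mk_add_mk, smul_eq_mul, hdefect] using hle ζ hζ

/-- The closed tube of radius `1` around the graph of `f` over the closed unit disc. -/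
noncomputable def graphTube (f : ℂ → ℂ) : Set (ℂ × ℂ) := {p | ‖p.2‖ ≤ 1 ∧ ‖p.1 - f p.2‖ ≤ 1}

theorem continuousOn_graphTube {f k : ℂ → ℂ} (hk : ContinuousOn k (closedBall 0 1)) :
    ContinuousOn (fun p : ℂ × ℂ => k p.2) (graphTube f) :=
  hk.comp continuousOn_snd fun _ hp => mem_closedBall_zero_iff.2 hp.1

theorem isCompact_graphTube {f : ℂ → ℂ} (hf : ContinuousOn f (closedBall 0 1)) :
    IsCompact (graphTube f) := by
  have himage : graphTube f = (fun p : ℂ × ℂ => (p.1 + f p.2, p.2)) ''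
      (closedBall 0 1 ×ˢ closedBall 0 1) := by
    ext ⟨w, t⟩
    constructor
    · rintro ⟨ht, hw⟩
      exact ⟨(w - f t, t), ⟨mem_closedBall_zero_iff.2 hw, mem_closedBall_zero_iff.2 ht⟩, by simp⟩
    · rintro ⟨⟨d, s⟩, ⟨hd, hs⟩, h⟩
      obtain ⟨rfl, rfl⟩ := Prod.mk.inj h
      exact ⟨mem_closedBall_zero_iff.1 hs, by simpa using hd⟩
  rw [himage]
  exact ((isCompact_closedBall 0 1).prod (isCompact_closedBall 0 1)).image_of_continuousOn
    ((continuousOn_fst.add (hf.comp continuousOn_snd fun p hp => hp.2)).prodMk continuousOn_snd)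

variable {v : ℂ × ℂ → EReal} {f k : ℂ → ℂ}

theorem continuousOn_norm_sub_graphTube (hf : ContinuousOn f (closedBall 0 1)) :
    ContinuousOn (fun p : ℂ × ℂ => ‖p.1 - f p.2‖) (graphTube f) :=
  (continuousOn_fst.sub (continuousOn_graphTube hf)).norm

theorem exists_le_re_add_penalty_of_le_re_on_circle (husc : UpperSemicontinuousOn v (graphTube f))
    (htop : ∀ p ∈ graphTube f, v p ≠ ⊤) (hf : ContinuousOn f (closedBall 0 1))
    (hk : ContinuousOn k (closedBall 0 1))
    (hle : ∀ τ : ℂ, ‖τ‖ = 1 → v (f τ, τ) ≤ ((k τ).re : EReal)) {η : ℝ} (hη : 0 < η) :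
    ∃ N : ℝ, 0 ≤ N ∧ ∀ p ∈ graphTube f, max ‖p.2‖ ‖p.1 - f p.2‖ = 1 →
      v p ≤ (((k p.2).re + η + N * ‖p.1 - f p.2‖ ^ 2 : ℝ) : EReal) := by
  have hdist := continuousOn_norm_sub_graphTube hf
  set B := graphTube f ∩ (fun p => max ‖p.2‖ ‖p.1 - f p.2‖) ⁻¹' {1}
  have hBK : B ⊆ graphTube f := Set.inter_subset_left
  have hB : IsCompact B := (isCompact_graphTube hf).of_isClosed_subset
    ((continuousOn_snd.norm.sup hdist).preimage_isClosed_of_isClosed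
      (isCompact_graphTube hf).isClosed isClosed_singleton) hBK
  have hgraph (p : ℂ × ℂ) (hp : p ∈ B) (h0 : ‖p.1 - f p.2‖ ^ 2 = 0) :
      v p ≤ ((k p.2).re : EReal) := by
    have hp2 : max ‖p.2‖ ‖p.1 - f p.2‖ = 1 := hp.2
    have hp1 : p.1 = f p.2 := by simpa [sub_eq_zero] using h0
    rw [pow_eq_zero_iff two_ne_zero] at h0
    rw [h0, max_eq_left (norm_nonneg _)] at hp2
    simpa [← hp1] using hle p.2 hp2
  obtain ⟨N, hN, hbdry⟩ := exists_forall_le_add_penalty hB (husc.mono hBK)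
    (fun p hp => htop p (hBK hp))
    ((Complex.continuous_re.comp_continuousOn (continuousOn_graphTube hk)).mono hBK)
    ((hdist.pow 2).mono hBK) (fun _ _ => sq_nonneg _) hgraph hη
  exact ⟨N, hN, fun p hp hp1 => hbdry p ⟨hp, hp1⟩⟩

/-- In the tube around the graph, `v` is compared with a strictly superharmonic majorant that
penalizes the distance to the graph. -/
theorem IsPlurisubharmonicOn.exists_le_re_add_of_le_re_on_circle
    (hv : IsPlurisubharmonicOn v (Set.univ ×ˢ ball 0 1))
    (husc : UpperSemicontinuousOn v (Set.univ ×ˢ closedBall 0 1))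
    (htop : ∀ p ∈ Set.univ ×ˢ closedBall 0 1, v p ≠ ⊤)
    (hf : DiffContOnCl ℂ f (ball 0 1)) (hk : DiffContOnCl ℂ k (ball 0 1))
    (hle : ∀ τ : ℂ, ‖τ‖ = 1 → v (f τ, τ) ≤ ((k τ).re : EReal)) {η : ℝ} (hη : 0 < η) :
    ∃ N : ℝ, ∀ p ∈ graphTube f, v p ≤
      (((k p.2 + η).re + η * (1 - ‖p.2‖ ^ 2) + N * ‖p.1 - f p.2‖ ^ 2 : ℝ) : EReal) := by
  have hKsub : graphTube f ⊆ Set.univ ×ˢ closedBall 0 1 := fun p hp =>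
    ⟨Set.mem_univ _, mem_closedBall_zero_iff.2 hp.1⟩
  have hkη := (continuousOn_graphTube (f := f) hk.continuousOn_ball).add
    (continuousOn_const (c := (η : ℂ)))
  have htopK (p : ℂ × ℂ) (hp : p ∈ graphTube f) := htop p (hKsub hp)
  obtain ⟨N, hN, hbdry⟩ := exists_le_re_add_penalty_of_le_re_on_circle (husc.mono hKsub) htopK
    hf.continuousOn_ball hk.continuousOn_ball hle hη
  refine ⟨N, hv.le_of_circleAverage_lt (isCompact_graphTube hf.continuousOn_ball)
    (husc.mono hKsub) htopK (((Complex.continuous_re.comp_continuousOn hkη).add (by fun_prop)).add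
      (((continuousOn_norm_sub_graphTube hf.continuousOn_ball).pow 2).const_smul N))
    fun p hp => ?_⟩
  rcases (max_le hp.1 hp.2).eq_or_lt with hpB | hlt
  · refine .inl ((hbdry p hp hpB).trans (EReal.coe_le_coe_iff.2 ?_))
    have : 0 ≤ η * (1 - ‖p.2‖ ^ 2) :=
      mul_nonneg hη.le (sub_nonneg.2 (pow_le_one₀ (norm_nonneg _) hp.1))
    rw [Complex.add_re, Complex.ofReal_re]
    linarith
  · obtain ⟨hp2, hp1⟩ := max_lt_iff.1 hlt
    obtain ⟨b, hb, h⟩ := exists_disc_circleAverage_lt hf.differentiableOn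
      (hk.differentiableOn.add_const (η : ℂ)) hη hN hp2 hp1
    exact .inr ⟨b, fun ζ hζ => ⟨⟨Set.mem_univ _, mem_ball_zero_iff.2 (hb ζ hζ).1⟩,
      (hb ζ hζ).1.le, (hb ζ hζ).2⟩, h⟩

theorem IsPlurisubharmonicOn.le_re_of_le_re_on_circle
    (hv : IsPlurisubharmonicOn v (Set.univ ×ˢ ball 0 1))
    (husc : UpperSemicontinuousOn v (Set.univ ×ˢ closedBall 0 1))
    (htop : ∀ p ∈ Set.univ ×ˢ closedBall 0 1, v p ≠ ⊤)
    (hf : DiffContOnCl ℂ f (ball 0 1)) (hk : DiffContOnCl ℂ k (ball 0 1))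
    (hle : ∀ τ : ℂ, ‖τ‖ = 1 → v (f τ, τ) ≤ ((k τ).re : EReal)) {τ : ℂ} (hτ : ‖τ‖ ≤ 1) :
    v (f τ, τ) ≤ ((k τ).re : EReal) := by
  have hbound {η : ℝ} (hη : 0 < η) :
      v (f τ, τ) ≤ (((k τ).re + η * (2 - ‖τ‖ ^ 2) : ℝ) : EReal) := by
    obtain ⟨N, hN⟩ := hv.exists_le_re_add_of_le_re_on_circle husc htop hf hk hle hη
    refine (hN (f τ, τ) ⟨hτ, by simp⟩).trans (EReal.coe_le_coe_iff.2 ?_)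
    rw [sub_self, norm_zero, Complex.add_re, Complex.ofReal_re]
    linarith
  have hlim : Tendsto (fun η : ℝ => (((k τ).re + η * (2 - ‖τ‖ ^ 2) : ℝ) : EReal)) (𝓝[>] 0)
      (𝓝 ((k τ).re : EReal)) := by
    have hcont : Continuous fun η : ℝ => (((k τ).re + η * (2 - ‖τ‖ ^ 2) : ℝ) : EReal) :=
      continuous_coe_real_ereal.comp (by fun_prop)
    exact (hcont.tendsto' 0 _ (by simp)).mono_left nhdsWithin_le_nhds
  exact ge_of_tendsto hlim (eventually_mem_nhdsWithin.mono fun _ hη => hbound hη)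

end HolomorphicGraph

section Candidates

theorem contDiff_fsPotential {n : WithTop ℕ∞} : ContDiff ℝ n fsPotential :=
  (contDiff_const.add (contDiff_norm_sq ℝ)).log fun _ => by positivity

theorem chart_mem_closedProduct (c : ℂ → P1) {q : ℂ × ℂ}
    (hq : q ∈ (Set.univ : Set ℂ) ×ˢ closedBall (0 : ℂ) 1) : (c q.1, q.2) ∈ closedProduct :=
  ⟨Set.mem_univ _, hq.2⟩

theorem circle_mem_closedProduct (τ : Circle) (x : P1) : (x, (τ : ℂ)) ∈ closedProduct :=
  ⟨Set.mem_univ _, by simp [Circle.norm_coe]⟩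

theorem ball_subset_closedBall_prod :
    (Set.univ : Set ℂ) ×ˢ ball (0 : ℂ) 1 ⊆ Set.univ ×ˢ closedBall 0 1 :=
  Set.prod_mono_right ball_subset_closedBall

theorem upperSemicontinuousOn_chart {ψ : P1 × ℂ → EReal}
    (hψ : UpperSemicontinuousOn ψ closedProduct) {c : ℂ → P1} (hc : c ∈ charts) :
    UpperSemicontinuousOn (fun q : ℂ × ℂ => (fsPotential q.1 : EReal) + ψ (c q.1, q.2))
      (Set.univ ×ˢ closedBall 0 1) := by
  have hcont : Continuous fun q : ℂ × ℂ => (c q.1, q.2) :=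
    ((isOpenEmbedding_chart hc).continuous.comp continuous_fst).prodMk continuous_snd
  exact upperSemicontinuousOn_coe_add
    (upperSemicontinuousOn_comp hψ hcont.continuousOn fun _ => chart_mem_closedProduct c)
    (contDiff_fsPotential.continuous (n := 0).comp continuous_fst).continuousOn

theorem upperSemicontinuousOn_congr {X : Type*} [TopologicalSpace X] {u v : X → EReal} {U : Set X}
    (hu : UpperSemicontinuousOn u U) (huv : Set.EqOn u v U) : UpperSemicontinuousOn v U :=
  fun p hp => UpperSemicontinuousWithinAt.congr_of_eventuallyEq (hu p hp) hp
    huv.eventuallyEq_nhdsWithin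

theorem IsPlurisubharmonicOn.congr {E : Type*} [NormedAddCommGroup E] [NormedSpace ℂ E]
    {u v : E → EReal} {U : Set E} (hu : IsPlurisubharmonicOn u U) (huv : Set.EqOn u v U) :
    IsPlurisubharmonicOn v U := by
  refine ⟨upperSemicontinuousOn_congr hu.1 huv, fun p hp => huv hp ▸ hu.2.1 p hp,
    fun a b hab g hg hle => ?_⟩
  rw [← huv (by simpa using hab 0 (by simp))]
  refine hu.2.2 a b hab g hg fun ζ hζ => ?_
  rw [huv (hab ζ (mem_sphere_zero_iff_norm.1 hζ).le)]
  exact hle ζ hζ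

variable {φ : Circle → P1 → ℝ} {ψ : P1 × ℂ → EReal}

theorem IsCandidate.congr {ψ' : P1 × ℂ → EReal} (h : IsCandidate φ ψ)
    (heq : Set.EqOn ψ ψ' closedProduct) : IsCandidate φ ψ' where
  usc := upperSemicontinuousOn_congr h.usc heq
  ne_top p hp := heq hp ▸ h.ne_top p hp
  psh c hc := (h.psh c hc).congr fun q hq => by
    simp only [heq (chart_mem_closedProduct c (ball_subset_closedBall_prod hq))]
  boundary_le τ x := heq (circle_mem_closedProduct τ x) ▸ h.boundary_le τ x

theorem isPlurisubharmonicOn_add_re {g : ℂ → ℝ} (hg : ContDiff ℝ 2 g)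
    (hΔ : ∀ z, 0 ≤ Δ g z) {k : ℂ → ℂ} (hk : Differentiable ℂ k)
    (U : Set (ℂ × ℂ)) :
    IsPlurisubharmonicOn (fun q : ℂ × ℂ => ((g q.1 + (k q.2).re : ℝ) : EReal)) U := by
  have hkc : Continuous fun ζ => (k ζ).re := Complex.continuous_re.comp hk.continuous
  refine isPlurisubharmonicOn_of_continuousOn (u := fun q : ℂ × ℂ => g q.1 + (k q.2).re)
    ((hg.continuous.comp continuous_fst).add (hkc.comp continuous_snd)).continuousOn fun a b _ => ?_
  simp only [Prod.fst_add, Prod.smul_fst, Prod.snd_add, Prod.smul_snd, smul_eq_mul]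
  have hline : Differentiable ℂ fun ζ : ℂ => a.1 + ζ * b.1 := by fun_prop
  have hsub : g a.1 ≤ Real.circleAverage (fun ζ : ℂ => g (a.1 + ζ * b.1)) 0 1 := by
    have h := le_circleAverage_of_laplacian_nonneg (g := g ∘ fun ζ : ℂ => a.1 + ζ * b.1)
      (hg.comp (by fun_prop)) fun z => by
        rw [laplacian_comp_analytic (hline.analyticAt z) hg.contDiffAt]
        exact mul_nonneg (sq_nonneg _) (hΔ _)
    simpa [Function.comp_def] using h
  have hmean : Real.circleAverage (fun ζ : ℂ => (k (a.2 + ζ * b.2)).re) 0 1 = (k a.2).re := by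
    have hkline : Differentiable ℂ fun ζ => k (a.2 + ζ * b.2) := hk.comp (by fun_prop)
    simpa using circleAverage_re hkline.diffContOnCl
  have hint {u : ℂ → ℝ} (hu : Continuous u) (z w : ℂ) :
      CircleIntegrable (fun ζ : ℂ => u (z + ζ * w)) 0 1 :=
    ContinuousOn.circleIntegrable zero_le_one (hu.comp (by fun_prop)).continuousOn
  rw [Real.circleAverage_fun_add (hint hg.continuous _ _) (hint hkc _ _), hmean]
  gcongr

theorem isCandidate_add_re {f : P1 → ℝ} {k : ℂ → ℂ}
    (hf : ∀ c ∈ charts, ContDiff ℝ 2 (fun ζ : ℂ => f (c ζ)) ∧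
      ∀ ζ : ℂ, 0 ≤ Δ (fun ξ : ℂ => fsPotential ξ + f (c ξ)) ζ)
    (hk : Differentiable ℂ k) (hle : ∀ (τ : Circle) (x : P1), f x + (k τ).re ≤ φ τ x) :
    IsCandidate φ (fun p => ((f p.1 + (k p.2).re : ℝ) : EReal)) := by
  have hfc : Continuous f := continuous_of_charts fun c hc => (hf c hc).1.continuous
  have hcont : Continuous fun p : P1 × ℂ => f p.1 + (k p.2).re :=
    (hfc.comp continuous_fst).add
      (Complex.continuous_re.comp (hk.continuous.comp continuous_snd))
  refine ⟨(continuous_coe_real_ereal.comp hcont).upperSemicontinuous.upperSemicontinuousOn _,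
    fun p _ => EReal.coe_ne_top _, fun c hc => ?_, fun τ x => EReal.coe_le_coe_iff.2 (hle τ x)⟩
  refine (isPlurisubharmonicOn_add_re (contDiff_fsPotential.add (hf c hc).1) (hf c hc).2 hk
    _).congr fun q _ => ?_
  simp only [← EReal.coe_add, add_assoc]

theorem IsCandidate.chart_le_re (hψ : IsCandidate φ ψ) {c : ℂ → P1} (hc : c ∈ charts)
    {f k : ℂ → ℂ} (hf : DiffContOnCl ℂ f (ball 0 1))
    (hk : DiffContOnCl ℂ k (ball 0 1))
    (hle : ∀ τ : Circle, fsPotential (f τ) + φ τ (c (f τ)) ≤ (k τ).re) {τ : ℂ} (hτ : ‖τ‖ ≤ 1) :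
    (fsPotential (f τ) : EReal) + ψ (c (f τ), τ) ≤ ((k τ).re : EReal) := by
  refine (hψ.psh c hc).le_re_of_le_re_on_circle (upperSemicontinuousOn_chart hψ.usc hc)
    (fun q hq => EReal.add_ne_top (EReal.coe_ne_top _)
      (hψ.ne_top _ (chart_mem_closedProduct c hq))) hf hk (fun σ hσ => ?_) hτ
  obtain ⟨σ, rfl⟩ : ∃ t : Circle, (t : ℂ) = σ := ⟨⟨σ, mem_sphere_zero_iff_norm.2 hσ⟩, rfl⟩
  rw [coe_add_le_coe_iff]
  exact (hψ.boundary_le σ _).trans (EReal.coe_le_coe_iff.2 (le_sub_iff_add_le'.2 (hle σ)))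

theorem IsCandidate.le_re (hψ : IsCandidate φ ψ) {x : P1} {k : ℂ → ℂ}
    (hk : DiffContOnCl ℂ k (ball 0 1)) (hle : ∀ τ : Circle, φ τ x ≤ (k τ).re) {τ : ℂ}
    (hτ : ‖τ‖ ≤ 1) : ψ (x, τ) ≤ ((k τ).re : EReal) := by
  obtain ⟨c, hc, w, rfl⟩ := exists_chart_eq x
  have h := hψ.chart_le_re hc (diffContOnCl_const (c := w)) (hk.const_add (fsPotential w : ℂ))
    (fun σ => by simpa using hle σ) hτ
  rw [coe_add_le_coe_iff] at h
  simpa using h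

end Candidates

section Envelope

/-- The upper semicontinuous regularization on `P1 × closed disc`. -/
noncomputable def uscRegularization (u : P1 × ℂ → EReal) (p : P1 × ℂ) : EReal :=
  limsup u (𝓝[closedProduct] p)

theorem le_uscRegularization (u : P1 × ℂ → EReal) {p : P1 × ℂ} (hp : p ∈ closedProduct) :
    u p ≤ uscRegularization u p :=
  le_limsup_of_frequently_le (Frequently.filter_mono
    (frequently_pure.2 le_rfl) (pure_le_nhdsWithin hp))

theorem uscRegularization_le {u : P1 × ℂ → EReal} {p : P1 × ℂ} {y : EReal}
    (h : ∀ᶠ q in 𝓝[closedProduct] p, u q ≤ y) : uscRegularization u p ≤ y :=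
  limsup_le_of_le (h := h)

theorem uscRegularization_le_of_continuousWithinAt {u : P1 × ℂ → EReal} {b : P1 × ℂ → ℝ}
    {p : P1 × ℂ} (hb : ContinuousWithinAt b closedProduct p)
    (h : ∀ᶠ q in 𝓝[closedProduct] p, u q ≤ (b q : EReal)) :
    uscRegularization u p ≤ (b p : EReal) := by
  refine le_of_forall_gt_imp_ge_of_dense fun y hy => uscRegularization_le ?_
  have hlim := (continuous_coe_real_ereal.tendsto (b p)).comp hb
  filter_upwards [h, hlim.eventually (gt_mem_nhds hy)] with q h₁ h₂ using h₁.trans h₂.le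

theorem upperSemicontinuousOn_uscRegularization (u : P1 × ℂ → EReal) :
    UpperSemicontinuousOn (uscRegularization u) closedProduct := by
  intro p _ y hy
  obtain ⟨y', hy', hlt⟩ := exists_between hy
  filter_upwards [eventually_eventually_nhdsWithin.2 (eventually_lt_of_limsup_lt hy')]
    with q hq using (uscRegularization_le (hq.mono fun _ h => h.le)).trans_lt hlt

theorem eventually_forall_disc_le {E : Type*} [NormedAddCommGroup E] [NormedSpace ℂ E]
    {u : E → EReal} {U : Set E} (hU : IsOpen U) (hu : UpperSemicontinuousOn u U) {a b : E}
    (hab : ∀ ζ : ℂ, ‖ζ‖ ≤ 1 → a + ζ • b ∈ U) {g : ℂ → ℝ}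
    (hg : ContinuousOn g (sphere 0 1))
    (hle : ∀ ζ ∈ sphere (0 : ℂ) 1, u (a + ζ • b) ≤ (g ζ : EReal)) {ε : ℝ} (hε : 0 < ε) :
    ∀ᶠ p in 𝓝 a, (∀ ζ : ℂ, ‖ζ‖ ≤ 1 → p + ζ • b ∈ U) ∧
      ∀ ζ ∈ sphere (0 : ℂ) 1, u (p + ζ • b) ≤ ((g ζ + ε : ℝ) : EReal) := by
  have hline : Continuous fun z : E × ℂ => z.1 + z.2 • b := by fun_prop
  have hdisc : ∀ᶠ p in 𝓝 a, ∀ ζ ∈ closedBall (0 : ℂ) 1, p + ζ • b ∈ U :=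
    (isCompact_closedBall 0 1).eventually_forall_of_forall_eventually fun ζ hζ =>
      hline.continuousAt.eventually (hU.mem_nhds (hab ζ (mem_closedBall_zero_iff.1 hζ)))
  have hcirc : ∀ᶠ p in 𝓝 a, ∀ ζ ∈ sphere (0 : ℂ) 1,
      ζ ∈ sphere (0 : ℂ) 1 → u (p + ζ • b) ≤ ((g ζ + ε : ℝ) : EReal) := by
    refine (isCompact_sphere 0 1).eventually_forall_of_forall_eventually fun ζ hζ => ?_
    have hmem : a + ζ • b ∈ U := hab ζ (mem_sphere_zero_iff_norm.1 hζ).le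
    have hnear : ∀ᶠ p in 𝓝 (a + ζ • b), u p < ((g ζ + ε / 2 : ℝ) : EReal) := by
      rw [← hU.nhdsWithin_eq hmem]
      exact hu _ hmem _ ((hle ζ hζ).trans_lt (EReal.coe_lt_coe_iff.2 (by linarith)))
    have hgnear : ∀ᶠ ξ in 𝓝 ζ, ξ ∈ sphere (0 : ℂ) 1 → g ζ - ε / 2 < g ξ :=
      eventually_nhdsWithin_iff.1 ((hg ζ hζ).eventually (lt_mem_nhds (by linarith)))
    filter_upwards [(hline.tendsto (a, ζ)).eventually hnear,
      (continuous_snd.tendsto (a, ζ)).eventually hgnear] with z hz hgz hsphere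
    exact hz.le.trans (EReal.coe_le_coe_iff.2 (by linarith [hgz hsphere]))
  filter_upwards [hdisc, hcirc] with p h₁ h₂
  exact ⟨fun ζ hζ => h₁ ζ (mem_closedBall_zero_iff.2 hζ), fun ζ hζ => h₂ ζ hζ hζ⟩

variable {φ : Circle → P1 → ℝ}

theorem le_envelope {ψ : P1 × ℂ → EReal} (hψ : IsCandidate φ ψ) (p : P1 × ℂ) :
    ψ p ≤ envelope φ p :=
  le_iSup₂ (f := fun (ψ : P1 × ℂ → EReal) (_ : IsCandidate φ ψ) => ψ p) ψ hψ

theorem envelope_le {p : P1 × ℂ} {y : EReal} (h : ∀ ψ, IsCandidate φ ψ → ψ p ≤ y) :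
    envelope φ p ≤ y :=
  iSup₂_le h

theorem uscRegularization_chart_le {u : P1 × ℂ → EReal} {c : ℂ → P1} (hc : c ∈ charts)
    {b : ℂ × ℂ → ℝ} (hb : Continuous b) {a : ℂ × ℂ} (ha : ‖a.2‖ < 1)
    (h : ∀ᶠ q in 𝓝 a, u (c q.1, q.2) ≤ (b q : EReal)) :
    uscRegularization u (c a.1, a.2) ≤ (b a : EReal) := by
  have hnhds : closedProduct ∈ 𝓝 (c a.1, a.2) := by
    rw [nhds_prod_eq]
    exact prod_mem_prod univ_mem (mem_of_superset
      (isOpen_ball.mem_nhds (mem_ball_zero_iff.2 ha)) ball_subset_closedBall)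
  refine le_of_forall_gt_imp_ge_of_dense fun y hy => uscRegularization_le ?_
  rw [nhdsWithin_eq_nhds.2 hnhds, nhds_chart_prod hc, eventually_map]
  filter_upwards [h, ((continuous_coe_real_ereal.comp hb).tendsto a).eventually (gt_mem_nhds hy)]
    with q h₁ h₂ using h₁.trans h₂.le

theorem isPlurisubharmonicOn_uscRegularization_envelope
    (htop : ∀ p ∈ closedProduct, uscRegularization (envelope φ) p ≠ ⊤) {c : ℂ → P1}
    (hc : c ∈ charts) : IsPlurisubharmonicOn
      (fun q : ℂ × ℂ => (fsPotential q.1 : EReal) + uscRegularization (envelope φ) (c q.1, q.2))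
      (Set.univ ×ˢ ball 0 1) := by
  have husc := (upperSemicontinuousOn_chart (upperSemicontinuousOn_uscRegularization (envelope φ))
    hc).mono ball_subset_closedBall_prod
  have hmem {q : ℂ × ℂ} (hq : q ∈ (Set.univ : Set ℂ) ×ˢ ball (0 : ℂ) 1) :
      (c q.1, q.2) ∈ closedProduct := chart_mem_closedProduct c (ball_subset_closedBall_prod hq)
  refine ⟨husc, fun p hp => EReal.add_ne_top (EReal.coe_ne_top _) (htop _ (hmem hp)),
    fun a b hab g hg hle => EReal.le_of_forall_lt_iff_le.1 fun y hy => ?_⟩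
  have ha : ‖a.2‖ < 1 := by simpa using (hab 0 (by simp)).2
  rw [coe_add_le_coe_iff]
  refine uscRegularization_chart_le hc (b := fun q => y - fsPotential q.1)
    (continuous_const.sub (contDiff_fsPotential.continuous (n := 0).comp continuous_fst)) ha ?_
  filter_upwards [eventually_forall_disc_le (isOpen_univ.prod isOpen_ball) husc hab hg hle
    (sub_pos.2 (EReal.coe_lt_coe_iff.1 hy))] with p hp
  refine envelope_le fun ψ hψ => coe_add_le_coe_iff.1 ?_
  have hsub := (hψ.psh c hc).2.2 p b hp.1 (fun ζ => g ζ + (y - Real.circleAverage g 0 1))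
    (hg.add continuousOn_const) fun ζ hζ => (add_le_add_right ((le_envelope hψ _).trans
      (le_uscRegularization _ (hmem (hp.1 ζ (mem_sphere_zero_iff_norm.1 hζ).le)))) _).trans
        (hp.2 ζ hζ)
  rwa [Real.circleAverage_fun_add (ContinuousOn.circleIntegrable zero_le_one hg)
    (circleIntegrable_const _ _ _), Real.circleAverage_const, add_sub_cancel] at hsub

end Envelope

section WeakSolution

/-- A holomorphic function on the disc whose real part is nonnegative and vanishes at `σ`. -/
noncomputable def peak (σ : Circle) (τ : ℂ) : ℂ := 1 - τ * (starRingEnd ℂ) (σ : ℂ)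

theorem differentiable_peak (σ : Circle) : Differentiable ℂ (peak σ) := by
  unfold peak
  fun_prop

theorem two_mul_re_peak_coe (σ τ : Circle) : 2 * (peak σ τ).re = ‖(τ : ℂ) - σ‖ ^ 2 := by
  rw [norm_sub_sq_real, Complex.inner, Circle.norm_coe, Circle.norm_coe, peak, Complex.sub_re,
    Complex.one_re]
  simp only [Complex.mul_re, Complex.conj_re, Complex.conj_im]
  ring

theorem re_peak_self (σ : Circle) : (peak σ σ).re = 0 := by
  simpa using two_mul_re_peak_coe σ σ

variable {φ : Circle → P1 → ℝ}

theorem exists_oscillation_bound (hφ : Continuous fun q : Circle × P1 => φ q.1 q.2) {ε : ℝ}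
    (hε : 0 < ε) :
    ∃ C : ℝ, ∀ (τ σ : Circle) (x : P1), |φ τ x - φ σ x| ≤ ε + C * (peak σ τ).re := by
  have hcont : Continuous fun q : Circle × Circle × P1 => |φ q.1 q.2.2 - φ q.2.1 q.2.2| :=
    ((hφ.comp (by fun_prop : Continuous fun q : Circle × Circle × P1 => (q.1, q.2.2))).sub
      (hφ.comp continuous_snd)).abs
  have husc : UpperSemicontinuousOn (fun q : Circle × Circle × P1 =>
      ((|φ q.1 q.2.2 - φ q.2.1 q.2.2| : ℝ) : EReal)) Set.univ :=
    (continuous_coe_real_ereal.comp hcont).upperSemicontinuous.upperSemicontinuousOn _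
  obtain ⟨C, -, hC⟩ := exists_forall_le_add_penalty (q := fun _ => 0)
    (g := fun q : Circle × Circle × P1 => ‖(q.1 : ℂ) - q.2.1‖ ^ 2) isCompact_univ
    husc (fun _ _ => EReal.coe_ne_top _) continuousOn_const (by fun_prop) (fun _ _ => by positivity)
    (fun q _ hq => by
      have : q.1 = q.2.1 := Circle.ext (by simpa [sub_eq_zero] using hq)
      simp [this]) hε
  refine ⟨C * 2, fun τ σ x => ?_⟩
  rw [mul_assoc, two_mul_re_peak_coe]
  simpa using EReal.coe_le_coe_iff.1 (hC (τ, σ, x) trivial)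

theorem IsCandidate.le_add_peak {ψ : P1 × ℂ → EReal} (hψ : IsCandidate φ ψ) {ε C : ℝ}
    (hC : ∀ (τ σ : Circle) (x : P1), |φ τ x - φ σ x| ≤ ε + C * (peak σ τ).re) (σ : Circle)
    {p : P1 × ℂ} (hp : p ∈ closedProduct) :
    ψ p ≤ ((φ σ p.1 + ε + C * (peak σ p.2).re : ℝ) : EReal) := by
  have hdiff : Differentiable ℂ fun τ => ((φ σ p.1 + ε : ℝ) : ℂ) + C * peak σ τ :=
    ((differentiable_peak σ).const_mul _).const_add _
  refine (hψ.le_re hdiff.diffContOnCl (fun τ => ?_) (mem_closedBall_zero_iff.1 hp.2)).trans_eq ?_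
  · rw [Complex.add_re, Complex.ofReal_re, Complex.re_ofReal_mul]
    linarith [le_of_abs_le (hC τ σ p.1)]
  · rw [Complex.add_re, Complex.ofReal_re, Complex.re_ofReal_mul]

theorem sub_peak_le_envelope (hK : ∀ τ, IsKahlerPotential (φ τ)) {ε C : ℝ}
    (hC : ∀ (τ σ : Circle) (x : P1), |φ τ x - φ σ x| ≤ ε + C * (peak σ τ).re) (σ : Circle)
    (p : P1 × ℂ) : ((φ σ p.1 - ε - C * (peak σ p.2).re : ℝ) : EReal) ≤ envelope φ p := by
  have hre (τ : ℂ) : (((-ε : ℝ) : ℂ) - C * peak σ τ).re = -ε - C * (peak σ τ).re := by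
    rw [Complex.sub_re, Complex.ofReal_re, Complex.re_ofReal_mul]
  have hcand := isCandidate_add_re (φ := φ) (f := φ σ) (k := fun τ => ((-ε : ℝ) : ℂ) - C * peak σ τ)
    (fun c hc => ⟨(hK σ c hc).1.of_le (WithTop.coe_le_coe.2 le_top),
      fun ζ => ((hK σ c hc).2 ζ).le⟩)
    (((differentiable_peak σ).const_mul _).const_sub _) fun τ x => by
      rw [hre]
      linarith [neg_le_of_abs_le (hC τ σ x)]
  refine le_trans (EReal.coe_le_coe_iff.2 (le_of_eq ?_)) (le_envelope hcand p)
  rw [hre]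
  ring

theorem isCandidate_uscRegularization_envelope (hφ : Continuous fun q : Circle × P1 => φ q.1 q.2) :
    IsCandidate φ (uscRegularization (envelope φ)) := by
  have hbound {ε : ℝ} (hε : 0 < ε) : ∃ C : ℝ, ∀ σ, ∀ p ∈ closedProduct,
      uscRegularization (envelope φ) p ≤ ((φ σ p.1 + ε + C * (peak σ p.2).re : ℝ) : EReal) := by
    obtain ⟨C, hC⟩ := exists_oscillation_bound hφ hε
    refine ⟨C, fun σ p _ => ?_⟩
    have hφσ : Continuous (φ σ) := hφ.comp (Continuous.prodMk_right σ)
    have hpeak := Complex.continuous_re.comp (differentiable_peak σ).continuous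
    refine uscRegularization_le_of_continuousWithinAt
      (b := fun p : P1 × ℂ => φ σ p.1 + ε + C * (peak σ p.2).re)
      (((hφσ.comp continuous_fst).add continuous_const).add
        (continuous_const.mul (hpeak.comp continuous_snd))).continuousWithinAt ?_
    filter_upwards [self_mem_nhdsWithin] with q hq
    exact envelope_le fun ψ hψ => hψ.le_add_peak hC σ hq
  have htop (p : P1 × ℂ) (hp : p ∈ closedProduct) : uscRegularization (envelope φ) p ≠ ⊤ := by
    obtain ⟨C, hC⟩ := hbound one_pos
    exact ((hC 1 p hp).trans_lt (EReal.coe_lt_top _)).ne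
  refine ⟨upperSemicontinuousOn_uscRegularization _, htop,
    fun c hc => isPlurisubharmonicOn_uscRegularization_envelope htop hc,
    fun τ x => EReal.le_of_forall_lt_iff_le.1 fun y hy => ?_⟩
  obtain ⟨C, hC⟩ := hbound (sub_pos.2 (EReal.coe_lt_coe_iff.1 hy))
  refine (hC τ _ (circle_mem_closedProduct τ x)).trans_eq ?_
  simp [re_peak_self]

theorem exists_isWeakSolution (hφ : Continuous fun q : Circle × P1 => φ q.1 q.2)
    (hK : ∀ τ, IsKahlerPotential (φ τ)) : ∃ Φ : P1 × ℂ → ℝ, IsWeakSolution φ Φ := by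
  have hcand := isCandidate_uscRegularization_envelope hφ
  have heq : Set.EqOn (uscRegularization (envelope φ)) (envelope φ) closedProduct := fun p hp =>
    le_antisymm (le_envelope hcand p) (le_uscRegularization _ hp)
  have hbot (p : P1 × ℂ) : envelope φ p ≠ ⊥ := by
    obtain ⟨C, hC⟩ := exists_oscillation_bound hφ one_pos
    exact ((EReal.bot_lt_coe _).trans_le (sub_peak_le_envelope hK hC 1 p)).ne'
  have hcoe (p : P1 × ℂ) (hp : p ∈ closedProduct) :
      ((envelope φ p).toReal : EReal) = envelope φ p :=
    EReal.coe_toReal (heq hp ▸ hcand.ne_top p hp) (hbot p)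
  refine ⟨fun p => (envelope φ p).toReal, hcoe,
    hcand.congr fun p hp => (heq hp).trans (hcoe p hp).symm, fun τ x => ?_⟩
  have hmem := circle_mem_closedProduct τ x
  refine le_antisymm ?_ (le_of_forall_pos_le_add fun ε hε => ?_)
  · rw [← EReal.coe_le_coe_iff, hcoe _ hmem, ← heq hmem]
    exact hcand.boundary_le τ x
  · obtain ⟨C, hC⟩ := exists_oscillation_bound hφ hε
    have hle := sub_peak_le_envelope hK hC τ (x, τ)
    rw [← hcoe _ hmem, EReal.coe_le_coe_iff, re_peak_self, mul_zero, sub_zero] at hle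
    exact sub_le_iff_le_add.1 hle

end WeakSolution

section RotatingDiscs

theorem exists_add_conj_mul_sq_eq {ρ : ℝ} {w τ : ℂ} (hτ : ‖τ‖ < 1)
    (hw : ‖w‖ ≤ ρ * (1 - ‖τ‖ ^ 2)) :
    ∃ e : ℂ, ‖e‖ ≤ ρ ∧ e + (starRingEnd ℂ) e * τ ^ 2 = w := by
  have hd : 0 < 1 - ‖τ‖ ^ 4 := sub_pos.2 (pow_lt_one₀ (norm_nonneg τ) hτ four_ne_zero)
  refine ⟨(w - τ ^ 2 * (starRingEnd ℂ) w) / ((1 - ‖τ‖ ^ 4 : ℝ) : ℂ), ?_, ?_⟩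
  · rw [norm_div, Complex.norm_real, Real.norm_of_nonneg hd.le, div_le_iff₀ hd]
    calc ‖w - τ ^ 2 * (starRingEnd ℂ) w‖ ≤ ‖w‖ + ‖τ ^ 2 * (starRingEnd ℂ) w‖ := norm_sub_le _ _
      _ = ‖w‖ * (1 + ‖τ‖ ^ 2) := by
        rw [norm_mul, norm_pow, RCLike.norm_conj]
        ring
      _ ≤ ρ * (1 - ‖τ‖ ^ 2) * (1 + ‖τ‖ ^ 2) := by gcongr
      _ = ρ * (1 - ‖τ‖ ^ 4) := by ring
  · have hττ : τ * (starRingEnd ℂ) τ = ((‖τ‖ ^ 2 : ℝ) : ℂ) := by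
      rw [Complex.mul_conj, Complex.normSq_eq_norm_sq]
    have hne : ((1 - ‖τ‖ ^ 4 : ℝ) : ℂ) ≠ 0 := Complex.ofReal_ne_zero.2 hd.ne'
    simp only [map_div₀, map_sub, map_mul, map_pow, Complex.conj_conj, Complex.conj_ofReal]
    field_simp
    push_cast at hττ ⊢
    linear_combination (-w) * (τ * (starRingEnd ℂ) τ + (‖τ‖ : ℂ) ^ 2) * hττ

theorem add_conj_mul_sq_coe (e : ℂ) (t : Circle) :
    e + (starRingEnd ℂ) e * (t : ℂ) ^ 2 = ((2 * (e * (starRingEnd ℂ) t).re : ℝ) : ℂ) * t := by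
  have ht : (t : ℂ) * (starRingEnd ℂ) t = 1 := by
    rw [Complex.mul_conj, Circle.normSq_coe, Complex.ofReal_one]
  rw [← Complex.add_conj, map_mul, Complex.conj_conj]
  linear_combination (-e) * ht

/-- The circle of the disc `t ↦ e + ē t²` is carried by the rotating segments, since
`e + ē t² = 2 Re (e t̄) t` for `|t| = 1`. -/
theorem IsCandidate.le_of_rotating_segment {φ : Circle → P1 → ℝ} {ψ : P1 × ℂ → EReal}
    (hψ : IsCandidate φ ψ) {c : ℂ → P1} (hc : c ∈ charts) {ρ a : ℝ}
    (hφ : ∀ (t : Circle) (s : ℝ), |s| ≤ 2 * ρ → fsPotential (s * t) + φ t (c (s * t)) ≤ a)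
    {w τ : ℂ} (hτ : ‖τ‖ < 1) (hw : ‖w‖ ≤ ρ * (1 - ‖τ‖ ^ 2)) :
    (fsPotential w : EReal) + ψ (c w, τ) ≤ a := by
  obtain ⟨e, he, rfl⟩ := exists_add_conj_mul_sq_eq hτ hw
  have hdisc : Differentiable ℂ fun t : ℂ => e + (starRingEnd ℂ) e * t ^ 2 := by fun_prop
  simpa using hψ.chart_le_re hc hdisc.diffContOnCl (diffContOnCl_const (c := (a : ℂ)))
    (fun t => by
      rw [add_conj_mul_sq_coe, Complex.ofReal_re]
      refine hφ t _ ?_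
      rw [abs_mul, abs_two]
      gcongr
      refine (Complex.abs_re_le_norm _).trans ?_
      rwa [norm_mul, RCLike.norm_conj, Circle.norm_coe, mul_one]) hτ.le

end RotatingDiscs

section SoftPosPart

/-- A smooth convex approximation of the positive part `t ↦ t⁺`: it vanishes for `t ≤ 0` and differs
from `t` by the constant `softPosPartGap` for `1 ≤ t`. -/
noncomputable def softPosPart (t : ℝ) : ℝ := ∫ s in (0 : ℝ)..t, Real.smoothTransition s

/-- The difference `t - softPosPart t` for large `t`. -/
noncomputable def softPosPartGap : ℝ := 1 - softPosPart 1

theorem hasDerivAt_softPosPart (t : ℝ) :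
    HasDerivAt softPosPart (Real.smoothTransition t) t :=
  (Real.smoothTransition.continuous.integral_hasStrictDerivAt 0 t).hasDerivAt

theorem deriv_softPosPart : deriv softPosPart = Real.smoothTransition :=
  funext fun t => (hasDerivAt_softPosPart t).deriv

theorem contDiff_softPosPart {n : ℕ∞} : ContDiff ℝ n softPosPart := by
  refine ContDiff.of_le (contDiff_infty_iff_deriv.2
    ⟨fun t => (hasDerivAt_softPosPart t).differentiableAt, ?_⟩) (WithTop.coe_le_coe.2 le_top)
  rw [deriv_softPosPart]
  exact Real.smoothTransition.contDiff

theorem monotone_softPosPart : Monotone softPosPart :=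
  monotone_of_hasDerivAt_nonneg hasDerivAt_softPosPart Real.smoothTransition.nonneg

theorem monotone_sub_softPosPart : Monotone fun t => t - softPosPart t :=
  monotone_of_hasDerivAt_nonneg (fun t => (hasDerivAt_id t).sub (hasDerivAt_softPosPart t))
    fun t => sub_nonneg.2 (Real.smoothTransition.le_one t)

theorem softPosPart_of_nonpos {t : ℝ} (ht : t ≤ 0) : softPosPart t = 0 := by
  refine intervalIntegral.integral_zero_ae (Eventually.of_forall fun s hs => ?_)
  rw [Set.uIoc_of_ge ht] at hs
  exact Real.smoothTransition.zero_of_nonpos hs.2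

theorem softPosPart_of_one_le {t : ℝ} (ht : 1 ≤ t) : softPosPart t = t - softPosPartGap := by
  have hint (a b : ℝ) : IntervalIntegrable Real.smoothTransition volume a b :=
    Real.smoothTransition.continuous.intervalIntegrable a b
  have hone : ∫ s in (1 : ℝ)..t, Real.smoothTransition s = ∫ _ in (1 : ℝ)..t, (1 : ℝ) :=
    intervalIntegral.integral_congr fun s hs => by
      rw [Set.uIcc_of_le ht] at hs
      exact Real.smoothTransition.one_of_one_le hs.1
  rw [softPosPart, ← intervalIntegral.integral_add_adjacent_intervals (hint 0 1) (hint 1 t), hone,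
    intervalIntegral.integral_const, softPosPartGap, softPosPart, smul_eq_mul]
  ring

theorem softPosPart_nonneg (t : ℝ) : 0 ≤ softPosPart t := by
  rcases le_total t 0 with ht | ht
  · rw [softPosPart_of_nonpos ht]
  · exact (softPosPart_of_nonpos le_rfl).ge.trans (monotone_softPosPart ht)

theorem softPosPart_pos {t : ℝ} (ht : 0 < t) : 0 < softPosPart t :=
  intervalIntegral.intervalIntegral_pos_of_pos_on
    (Real.smoothTransition.continuous.intervalIntegrable 0 t)
    (fun _ hs => Real.smoothTransition.pos_of_pos hs.1) ht

theorem softPosPart_le {t : ℝ} (ht : 0 ≤ t) : softPosPart t ≤ t := by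
  have h := monotone_sub_softPosPart ht
  simp only [softPosPart_of_nonpos le_rfl, sub_zero] at h
  linarith

theorem softPosPartGap_nonneg : 0 ≤ softPosPartGap :=
  sub_nonneg.2 (softPosPart_le zero_le_one)

theorem sub_softPosPartGap_le (t : ℝ) : t - softPosPartGap ≤ softPosPart t := by
  rcases le_total t 1 with ht | ht
  · have h := monotone_sub_softPosPart ht
    simp only at h
    rw [softPosPartGap]
    linarith
  · exact (softPosPart_of_one_le ht).ge

theorem le_laplacian_softPosPart_comp {u : ℂ → ℝ} (hu : ContDiff ℝ 2 u) (z : ℂ) :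
    Real.smoothTransition (u z) * Δ u z ≤ Δ (fun w => softPosPart (u w)) z := by
  have h := laplacian_comp_real (z := z) (contDiff_softPosPart (n := 2)).contDiffAt hu.contDiffAt
  rw [deriv_softPosPart] at h
  refine le_of_le_of_eq ?_ h.symm
  have := Real.smoothTransition.monotone.deriv_nonneg (x := u z)
  exact le_add_of_nonneg_left (by positivity)

end SoftPosPart

section Profile

theorem laplacian_add_const {u : ℂ → ℝ} {z : ℂ} (hu : ContDiffAt ℝ 2 u z) (a : ℝ) :
    Δ (fun w => u w + a) z = Δ u z := by
  have h : Δ (fun w => u w + a) z = Δ u z + Δ (fun _ : ℂ => a) z :=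
    hu.laplacian_add contDiffAt_const
  rwa [InnerProductSpace.laplacian_const, Pi.zero_apply, add_zero] at h

theorem laplacian_fsPotential_pos (z : ℂ) : 0 < Δ fsPotential z := by
  have h : Δ fsPotential z = 4 * 1 / (1 + ‖z‖ ^ 2) ^ 2 :=
    laplacian_log_add_norm_sq one_pos z
  rw [h]
  positivity

theorem fsPotential_congr_norm {z w : ℂ} (h : ‖z‖ = ‖w‖) : fsPotential z = fsPotential w := by
  rw [fsPotential, fsPotential, h]

/-- A function of `Im w` that is constant on the real axis, and strictly subharmonic where it
exceeds `fsPotential`. -/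
noncomputable def stripPotential (w : ℂ) : ℝ := Real.log (6 + w.im ^ 2 / 2)

theorem contDiff_stripPotential {n : WithTop ℕ∞} : ContDiff ℝ n stripPotential := by
  have him : ContDiff ℝ n fun w : ℂ => w.im := Complex.imCLM.contDiff
  exact ContDiff.log (by fun_prop) fun w => by positivity

theorem laplacian_stripPotential (w : ℂ) :
    Δ stripPotential w = (6 - w.im ^ 2 / 2) / (6 + w.im ^ 2 / 2) ^ 2 := by
  have hpos (y : ℝ) : 0 < 6 + y ^ 2 / 2 := by positivity
  have hsq (y : ℝ) : HasDerivAt (fun y : ℝ => 6 + y ^ 2 / 2) y y := by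
    simpa using ((hasDerivAt_pow 2 y).div_const 2).const_add 6
  have hD : deriv (fun y : ℝ => Real.log (6 + y ^ 2 / 2)) = fun y => y / (6 + y ^ 2 / 2) :=
    funext fun y => ((hsq y).log (hpos y).ne').deriv
  have hD₂ (y : ℝ) : deriv (fun y : ℝ => y / (6 + y ^ 2 / 2)) y
      = (6 - y ^ 2 / 2) / (6 + y ^ 2 / 2) ^ 2 := by
    refine HasDerivAt.deriv (((hasDerivAt_id' y).div (hsq y) (hpos y).ne').congr_deriv ?_)
    congr 1
    ring
  have him : fderiv ℝ (fun w : ℂ => w.im) = fun _ => Complex.imCLM :=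
    funext fun w => Complex.imCLM.fderiv
  have h := laplacian_comp_real (f := fun y : ℝ => Real.log (6 + y ^ 2 / 2)) (z := w)
    (u := fun w : ℂ => w.im) (ContDiffAt.log (by fun_prop) (hpos _).ne')
    Complex.imCLM.contDiff.contDiffAt
  rw [laplacian_eq_fderiv (fun w : ℂ => w.im), hD, hD₂, him] at h
  refine Eq.trans h ?_
  simp

theorem log_six_le_stripPotential (w : ℂ) : Real.log 6 ≤ stripPotential w :=
  Real.log_le_log (by norm_num) (by linarith [sq_nonneg w.im])

theorem stripPotential_le_fsPotential {w : ℂ} (hw : 10 ≤ ‖w‖ ^ 2) :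
    stripPotential w ≤ fsPotential w := by
  have him : w.im ^ 2 ≤ ‖w‖ ^ 2 := sq_le_sq.2 (by simpa using Complex.abs_im_le_norm w)
  exact Real.log_le_log (by positivity) (by linarith)

theorem laplacian_stripPotential_pos {w : ℂ} (hw : fsPotential w < stripPotential w) :
    0 < Δ stripPotential w := by
  have him : w.im ^ 2 ≤ ‖w‖ ^ 2 := sq_le_sq.2 (by simpa using Complex.abs_im_le_norm w)
  have hlt : ‖w‖ ^ 2 < 10 := lt_of_not_ge fun h => hw.not_ge (stripPotential_le_fsPotential h)
  rw [laplacian_stripPotential]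
  exact div_pos (by linarith) (by positivity)

/-- The Kähler potential at `τ = 1`, in the coordinate `w`: the local potential
`fsPotential + profile` is a smooth maximum of `fsPotential` and `stripPotential`. -/
noncomputable def profile (w : ℂ) : ℝ := softPosPart (stripPotential w - fsPotential w)

/-- The value of `fsPotential + profile` on the segment `[-1, 1]`. -/
noncomputable def flatValue : ℝ := Real.log 6 - softPosPartGap

theorem contDiff_profile : ContDiff ℝ ∞ profile :=
  contDiff_softPosPart.comp (contDiff_stripPotential.sub contDiff_fsPotential)

theorem profile_eq_zero {w : ℂ} (hw : 5 ≤ ‖w‖) : profile w = 0 :=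
  softPosPart_of_nonpos (sub_nonpos.2 (stripPotential_le_fsPotential (by nlinarith)))

theorem fsPotential_add_profile_ofReal {s : ℝ} (hs : |s| ≤ 1) :
    fsPotential s + profile s = flatValue := by
  have hstrip : stripPotential s = Real.log 6 := by simp [stripPotential]
  have hs2 : 1 + ‖(s : ℂ)‖ ^ 2 ≤ 2 := by
    rw [Complex.norm_real, Real.norm_eq_abs]
    linarith [pow_le_one₀ (n := 2) (abs_nonneg s) hs]
  have hgap : 1 ≤ Real.log 6 - fsPotential s := by
    rw [fsPotential, ← Real.log_div (by norm_num) (by positivity),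
      Real.le_log_iff_exp_le (by positivity)]
    refine Real.exp_one_lt_three.le.trans ((le_div_iff₀ (by positivity)).2 ?_)
    linarith
  rw [profile, hstrip, softPosPart_of_one_le hgap, flatValue]
  ring

theorem fsPotential_le_add_profile (w : ℂ) : fsPotential w ≤ fsPotential w + profile w :=
  le_add_of_nonneg_right (softPosPart_nonneg _)

theorem flatValue_le_add_profile (w : ℂ) : flatValue ≤ fsPotential w + profile w := by
  have h := sub_softPosPartGap_le (stripPotential w - fsPotential w)
  rw [flatValue, profile]
  linarith [log_six_le_stripPotential w]

theorem laplacian_add_profile_pos (w : ℂ) : 0 < Δ (fun w => fsPotential w + profile w) w := by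
  have hfs : ContDiff ℝ 2 fsPotential := contDiff_fsPotential
  have hstrip : ContDiff ℝ 2 stripPotential := contDiff_stripPotential
  have hprofile : ContDiff ℝ 2 profile := contDiff_profile.of_le (WithTop.coe_le_coe.2 le_top)
  have hle := le_laplacian_softPosPart_comp (hstrip.sub hfs) w
  have hsub : Δ (fun w => stripPotential w - fsPotential w) w
      = Δ stripPotential w - Δ fsPotential w :=
    hstrip.contDiffAt.laplacian_sub hfs.contDiffAt
  have hadd : Δ (fun w => fsPotential w + profile w) w = Δ fsPotential w + Δ profile w :=
    hfs.contDiffAt.laplacian_add hprofile.contDiffAt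
  rw [hadd]
  rw [hsub] at hle
  change _ ≤ Δ profile w at hle
  rcases le_or_gt (stripPotential w) (fsPotential w) with h | h
  · rw [Real.smoothTransition.zero_of_nonpos (sub_nonpos.2 h), zero_mul] at hle
    linarith [laplacian_fsPotential_pos w]
  · have hθ := Real.smoothTransition.pos_of_pos (sub_pos.2 h)
    have hθ1 := Real.smoothTransition.le_one (stripPotential w - fsPotential w)
    nlinarith [laplacian_fsPotential_pos w, mul_pos hθ (laplacian_stripPotential_pos h)]

/-- A competitor for the envelope, in the coordinate `w` and up to the constant `softPosPartGap`:
the local potential `fsPotential + flatProfile - softPosPartGap` is at least `flatValue`, and larger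
than that for large `w`. -/
noncomputable def flatProfile (w : ℂ) : ℝ :=
  Real.log 6 + softPosPart (fsPotential w - flatValue) - fsPotential w

theorem contDiff_flatProfile : ContDiff ℝ ∞ flatProfile :=
  (contDiff_const.add (contDiff_softPosPart.comp (contDiff_fsPotential.sub contDiff_const))).sub
    contDiff_fsPotential

theorem fsPotential_add_flatProfile (w : ℂ) :
    fsPotential w + flatProfile w - softPosPartGap
      = flatValue + softPosPart (fsPotential w - flatValue) := by
  rw [flatProfile, flatValue]
  ring

theorem flatProfile_eq_zero {w : ℂ} (hw : 5 ≤ ‖w‖) : flatProfile w = 0 := by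
  have hlog : Real.log 6 + 1 ≤ fsPotential w := by
    rw [← Real.log_exp 1, ← Real.log_mul (by norm_num) (Real.exp_ne_zero 1)]
    exact Real.log_le_log (by positivity) (by nlinarith [Real.exp_one_lt_three])
  have hflat : flatValue ≤ Real.log 6 := sub_le_self _ softPosPartGap_nonneg
  rw [flatProfile, softPosPart_of_one_le (by linarith), flatValue]
  ring

theorem flatProfile_sub_le_profile (w : ℂ) : flatProfile w - softPosPartGap ≤ profile w := by
  have hflat := fsPotential_add_flatProfile w
  rcases le_total (fsPotential w) flatValue with h | h
  · rw [softPosPart_of_nonpos (sub_nonpos.2 h)] at hflat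
    linarith [flatValue_le_add_profile w]
  · linarith [softPosPart_le (sub_nonneg.2 h), fsPotential_le_add_profile w]

theorem laplacian_add_flatProfile_nonneg (w : ℂ) :
    0 ≤ Δ (fun w => fsPotential w + flatProfile w) w := by
  have hfs : ContDiff ℝ 2 fun w => fsPotential w + -flatValue :=
    contDiff_fsPotential.add contDiff_const
  have heq : (fun w => fsPotential w + flatProfile w)
      = fun w => softPosPart (fsPotential w + -flatValue) + Real.log 6 := by
    funext w
    rw [flatProfile, sub_eq_add_neg (fsPotential w)]
    ring
  rw [heq, laplacian_add_const (u := fun w => softPosPart (fsPotential w + -flatValue))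
    (contDiff_softPosPart.comp hfs).contDiffAt]
  refine le_trans ?_ (le_laplacian_softPosPart_comp hfs w)
  rw [laplacian_add_const contDiff_fsPotential.contDiffAt]
  exact mul_nonneg (Real.smoothTransition.nonneg _) (laplacian_fsPotential_pos w).le

end Profile

section ExtendByZero

/-- The extension to `P1` of a function of the coordinate `w`, by `0` at `w = ∞`. -/
noncomputable def extendByZero (v : ℂ → ℝ) (x : P1) : ℝ := OnePoint.elim (inversion x) 0 v

variable {v : ℂ → ℝ} {R : ℝ}

theorem extendByZero_chartW (w : ℂ) : extendByZero v (chartW w) = v w := by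
  rw [extendByZero, ← inversion_coe, inversion_inversion]
  rfl

theorem extendByZero_chartZ_of_ne {z : ℂ} (hz : z ≠ 0) : extendByZero v (chartZ z) = v z⁻¹ := by
  rw [← extendByZero_chartW (v := v), chartW_of_ne (inv_ne_zero hz), inv_inv]

theorem extendByZero_chartZ_eq_zero (hv : ∀ w, R ≤ ‖w‖ → v w = 0) {z : ℂ} (hz : ‖z‖ * R ≤ 1) :
    extendByZero v (chartZ z) = 0 := by
  rcases eq_or_ne z 0 with rfl | hz0
  · rw [← inversion_infty, extendByZero, inversion_inversion]
    rfl
  · rw [extendByZero_chartZ_of_ne hz0]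
    refine hv _ ?_
    rwa [norm_inv, ← one_div, le_div_iff₀' (norm_pos_iff.2 hz0)]

theorem eventually_norm_mul_le_one (R : ℝ) : ∀ᶠ z : ℂ in 𝓝 0, ‖z‖ * R ≤ 1 :=
  (Continuous.tendsto' (by fun_prop) 0 0 (by simp)).eventually_le_const one_pos

theorem contDiff_extendByZero {E : Type*} [NormedAddCommGroup E] [NormedSpace ℝ E]
    {V : E → ℂ → ℝ} {n : WithTop ℕ∞} (hV : ContDiff ℝ n fun q : E × ℂ => V q.1 q.2)
    (hR : ∀ e w, R ≤ ‖w‖ → V e w = 0) {c : ℂ → P1} (hc : c ∈ charts) :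
    ContDiff ℝ n fun q : E × ℂ => extendByZero (V q.1) (c q.2) := by
  rcases hc with rfl | rfl
  · refine contDiff_iff_contDiffAt.2 fun ⟨e, z⟩ => ?_
    rcases eq_or_ne z 0 with rfl | hz
    · refine (contDiffAt_const (c := (0 : ℝ))).congr_of_eventuallyEq ?_
      filter_upwards [continuousAt_snd.eventually (eventually_norm_mul_le_one R)] with q hq
      exact extendByZero_chartZ_eq_zero (hR q.1) hq
    · refine ContDiffAt.congr_of_eventuallyEq (f := fun q : E × ℂ => V q.1 q.2⁻¹)
        (hV.contDiffAt.comp (e, z) (contDiffAt_fst.prodMk (contDiffAt_snd.inv hz))) ?_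
      filter_upwards [continuousAt_snd.eventually (isOpen_ne.mem_nhds hz)] with q hq
      exact extendByZero_chartZ_of_ne hq
  · simpa only [extendByZero_chartW] using hV

theorem fsPotential_inv {z : ℂ} (hz : z ≠ 0) :
    fsPotential z⁻¹ = fsPotential z - 2 * Real.log ‖z‖ := by
  have h2 : 2 * Real.log ‖z‖ = Real.log (‖z‖ ^ 2) := by simp
  rw [fsPotential, fsPotential, norm_inv, h2, ← Real.log_div (by positivity) (by positivity)]
  congr 1
  field_simp
  ring

theorem laplacian_const_mul_log_norm {z : ℂ} (hz : z ≠ 0) (a : ℝ) :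
    ContDiffAt ℝ 2 (fun z : ℂ => a * Real.log ‖z‖) z ∧ Δ (fun z : ℂ => a * Real.log ‖z‖) z = 0 := by
  have h : InnerProductSpace.HarmonicAt (fun z : ℂ => a • Real.log ‖z‖) z :=
    (analyticAt_id.harmonicAt_log_norm hz).const_smul
  exact ⟨h.1, h.2.eq_of_nhds⟩

/-- In the coordinate `z` the local potential is that of `w = z⁻¹` plus the harmonic function
`2 log ‖z‖`. -/
theorem laplacian_extendByZero_chartZ_of_ne (hv : ContDiff ℝ 2 v) {z : ℂ} (hz : z ≠ 0) :
    Δ (fun ξ => fsPotential ξ + extendByZero v (chartZ ξ)) z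
      = ‖deriv Inv.inv z‖ ^ 2 * Δ (fun w => fsPotential w + v w) z⁻¹ := by
  have hg : ContDiff ℝ 2 fun w => fsPotential w + v w := contDiff_fsPotential.add hv
  obtain ⟨hlog, hlog0⟩ := laplacian_const_mul_log_norm hz 2
  have hinv : AnalyticAt ℂ Inv.inv z := analyticAt_inv hz
  have heq : (fun ξ => fsPotential ξ + extendByZero v (chartZ ξ))
      =ᶠ[𝓝 z] ((fun w => fsPotential w + v w) ∘ Inv.inv) + fun ξ => 2 * Real.log ‖ξ‖ := by
    filter_upwards [isOpen_ne.mem_nhds hz] with ξ hξ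
    rw [extendByZero_chartZ_of_ne hξ, Pi.add_apply, Function.comp_apply, fsPotential_inv hξ]
    ring
  rw [(InnerProductSpace.laplacian_congr_nhds heq).eq_of_nhds, ContDiffAt.laplacian_add
    (hg.contDiffAt.comp z (contDiffAt_real_of_analyticAt hinv)) hlog, hlog0, add_zero,
    laplacian_comp_analytic hinv hg.contDiffAt]

theorem laplacian_extendByZero_chartZ_zero (hv : ∀ w, R ≤ ‖w‖ → v w = 0) :
    Δ (fun ξ => fsPotential ξ + extendByZero v (chartZ ξ)) 0 = Δ fsPotential 0 := by
  refine (InnerProductSpace.laplacian_congr_nhds ?_).eq_of_nhds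
  filter_upwards [eventually_norm_mul_le_one R] with ξ hξ
  rw [extendByZero_chartZ_eq_zero hv hξ, add_zero]

theorem exists_laplacian_extendByZero_eq (hv : ContDiff ℝ 2 v) (hR : ∀ w, R ≤ ‖w‖ → v w = 0)
    {c : ℂ → P1} (hc : c ∈ charts) (ζ : ℂ) :
    ∃ t > 0, ∃ w, Δ (fun ξ => fsPotential ξ + extendByZero v (c ξ)) ζ
      = t * Δ (fun w => fsPotential w + v w) w := by
  rcases hc with rfl | rfl
  · rcases eq_or_ne ζ 0 with rfl | hζ
    · obtain ⟨w, hw⟩ := NormedSpace.exists_lt_norm ℂ ℂ R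
      have heq : Δ (fun w => fsPotential w + v w) w = Δ fsPotential w := by
        refine (InnerProductSpace.laplacian_congr_nhds ?_).eq_of_nhds
        filter_upwards [continuous_norm.continuousAt.eventually (lt_mem_nhds hw)] with ξ hξ
        rw [hR ξ hξ.le, add_zero]
      refine ⟨_, div_pos (laplacian_fsPotential_pos 0) (laplacian_fsPotential_pos w), w, ?_⟩
      rw [laplacian_extendByZero_chartZ_zero hR, heq,
        div_mul_cancel₀ _ (laplacian_fsPotential_pos w).ne']
    · refine ⟨_, pow_pos (norm_pos_iff.2 ?_) 2, _, laplacian_extendByZero_chartZ_of_ne hv hζ⟩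
      rw [deriv_inv, neg_ne_zero]
      exact inv_ne_zero (pow_ne_zero 2 hζ)
  · simp only [extendByZero_chartW]
    exact ⟨1, one_pos, ζ, (one_mul _).symm⟩

end ExtendByZero

section RotatedPotential

theorem IsSmoothFamily.continuous {φ : Circle → P1 → ℝ} (hφ : IsSmoothFamily φ) :
    Continuous fun q : Circle × P1 => φ q.1 q.2 := by
  refine continuous_iff_continuousAt.2 fun ⟨τ, x⟩ => ?_
  obtain ⟨c, hc, ζ, rfl⟩ := exists_chart_eq x
  obtain ⟨θ, rfl⟩ := Circle.exp_surjective τ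
  rw [ContinuousAt, nhds_prod_eq, ← isLocalHomeomorph_circleExp.map_nhds_eq θ,
    ← (isOpenEmbedding_chart hc).map_nhds_eq ζ, prod_map_map_eq, ← nhds_prod_eq]
  exact tendsto_map'_iff.2 ((hφ c hc).continuous.tendsto (θ, ζ))

/-- The boundary data `φ_τ`: the function `profile`, rotated by `τ` in the coordinate `w`. -/
noncomputable def rotatedPotential (τ : Circle) : P1 → ℝ :=
  extendByZero fun w => profile ((τ⁻¹ : Circle) * w)

theorem norm_circle_mul (τ : Circle) (w : ℂ) : ‖(τ : ℂ) * w‖ = ‖w‖ := by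
  rw [norm_mul, Circle.norm_coe, one_mul]

theorem profile_circle_mul_eq_zero (τ : Circle) {w : ℂ} (hw : 5 ≤ ‖w‖) :
    profile (τ * w) = 0 :=
  profile_eq_zero (by rwa [norm_circle_mul])

theorem isSmoothFamily_rotatedPotential : IsSmoothFamily rotatedPotential := by
  intro c hc
  refine contDiff_extendByZero (R := 5) (V := fun θ w => profile (((Circle.exp θ)⁻¹ : Circle) * w))
    (contDiff_profile.comp ?_) (fun θ w hw => profile_circle_mul_eq_zero _ hw) hc
  simp only [← Circle.exp_neg, Circle.coe_exp]
  have hexp : ContDiff ℝ ∞ fun q : ℝ × ℂ => ((-q.1 : ℝ) : ℂ) * Complex.I :=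
    (Complex.ofRealCLM.contDiff.comp contDiff_fst.neg).mul contDiff_const
  exact hexp.cexp.mul contDiff_snd

theorem laplacian_add_profile_circle_mul_pos (τ : Circle) (w : ℂ) :
    0 < Δ (fun w => fsPotential w + profile (τ * w)) w := by
  have hg : ContDiff ℝ ∞ fun w => fsPotential w + profile w :=
    contDiff_fsPotential.add contDiff_profile
  have hf : AnalyticAt ℂ (fun w => (τ : ℂ) * w) w := by fun_prop
  have hfs (w : ℂ) : fsPotential w = fsPotential (τ * w) :=
    fsPotential_congr_norm (norm_circle_mul τ w).symm
  have h := laplacian_comp_analytic hf (hg.of_le (WithTop.coe_le_coe.2 le_top)).contDiffAt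
  rw [deriv_const_mul_id', Circle.norm_coe, one_pow, one_mul] at h
  have heq : (fun w => fsPotential w + profile (τ * w))
      = (fun w => fsPotential w + profile w) ∘ fun w => (τ : ℂ) * w :=
    funext fun w => congrArg (· + profile (τ * w)) (hfs w)
  rw [heq, h]
  exact laplacian_add_profile_pos _

theorem isKahlerPotential_rotatedPotential (τ : Circle) :
    IsKahlerPotential (rotatedPotential τ) := by
  have hsmooth : ContDiff ℝ ∞ fun w => profile ((τ⁻¹ : Circle) * w) :=
    contDiff_profile.comp (contDiff_const.mul contDiff_id)
  have hzero (w : ℂ) (hw : 5 ≤ ‖w‖) := profile_circle_mul_eq_zero τ⁻¹ hw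
  intro c hc
  refine ⟨(contDiff_extendByZero (V := fun _ : ℂ => _) (hsmooth.comp contDiff_snd)
    (fun _ => hzero) hc).comp (contDiff_id.prodMk contDiff_id), fun ζ => ?_⟩
  obtain ⟨t, ht, w, h⟩ := exists_laplacian_extendByZero_eq
    (hsmooth.of_le (WithTop.coe_le_coe.2 le_top)) hzero hc ζ
  rw [rotatedPotential, h]
  exact mul_pos ht (laplacian_add_profile_circle_mul_pos _ w)

theorem fsPotential_add_rotatedPotential_segment (τ : Circle) {s : ℝ} (hs : |s| ≤ 1) :
    fsPotential (s * τ) + rotatedPotential τ (chartW (s * τ)) = flatValue := by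
  have hs' : ((τ⁻¹ : Circle) : ℂ) * (s * τ) = s := by
    rw [Circle.coe_inv, mul_left_comm, inv_mul_cancel₀ (Circle.coe_ne_zero τ), mul_one]
  rw [rotatedPotential, extendByZero_chartW, hs',
    ← fsPotential_congr_norm (norm_circle_mul τ⁻¹ (s * τ)), hs', fsPotential_add_profile_ofReal hs]

theorem isCandidate_flatProfile : IsCandidate rotatedPotential
    fun p => ((extendByZero flatProfile p.1 - softPosPartGap : ℝ) : EReal) := by
  have hsmooth : ContDiff ℝ 2 flatProfile :=
    contDiff_flatProfile.of_le (WithTop.coe_le_coe.2 le_top)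
  have hzero (w : ℂ) := flatProfile_eq_zero (w := w)
  refine isCandidate_add_re (k := fun _ => ((-softPosPartGap : ℝ) : ℂ)) (fun c hc =>
    ⟨(contDiff_extendByZero (V := fun _ : ℂ => flatProfile) (hsmooth.comp contDiff_snd)
      (fun _ => hzero) hc).comp (contDiff_id.prodMk contDiff_id), fun ζ => ?_⟩)
    (differentiable_const _) fun τ x => ?_
  · obtain ⟨t, ht, w, h⟩ := exists_laplacian_extendByZero_eq hsmooth hzero hc ζ
    rw [h]
    exact mul_nonneg ht.le (laplacian_add_flatProfile_nonneg w)
  · rw [Complex.ofReal_re, ← sub_eq_add_neg, rotatedPotential, extendByZero, extendByZero]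
    generalize inversion x = y
    induction y using OnePoint.rec with
    | infty => exact sub_nonpos.2 softPosPartGap_nonneg
    | coe w =>
      have hrot : flatProfile ((τ⁻¹ : Circle) * w) = flatProfile w := by
        rw [flatProfile, flatProfile, fsPotential_congr_norm (norm_circle_mul τ⁻¹ w)]
      exact (sub_le_sub_right hrot.ge softPosPartGap).trans (flatProfile_sub_le_profile _)

variable {Φ : P1 × ℂ → ℝ} {w τ : ℂ}

theorem flatValue_add_softPosPart_le (hΦ : IsWeakSolution rotatedPotential Φ) (hτ : ‖τ‖ ≤ 1) :
    flatValue + softPosPart (fsPotential w - flatValue) ≤ fsPotential w + Φ (chartW w, τ) := by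
  have hmem : (chartW w, τ) ∈ closedProduct := ⟨Set.mem_univ _, mem_closedBall_zero_iff.2 hτ⟩
  have h := le_envelope isCandidate_flatProfile (chartW w, τ)
  rw [← hΦ.eq_envelope _ hmem, EReal.coe_le_coe_iff, extendByZero_chartW] at h
  linarith [fsPotential_add_flatProfile w]

theorem eq_flatValue (hΦ : IsWeakSolution rotatedPotential Φ) (hτ : ‖τ‖ < 1)
    (hw : ‖w‖ ≤ 1 / 2 * (1 - ‖τ‖ ^ 2)) : fsPotential w + Φ (chartW w, τ) = flatValue := by
  refine le_antisymm ?_ (le_trans (le_add_of_nonneg_right (softPosPart_nonneg _))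
    (flatValue_add_softPosPart_le hΦ hτ.le))
  have h := hΦ.candidate.le_of_rotating_segment (c := chartW) (by simp [charts]) (a := flatValue)
    (fun t s hs => (fsPotential_add_rotatedPotential_segment t (by linarith)).le) hτ hw
  rwa [← EReal.coe_add, EReal.coe_le_coe_iff] at h

end RotatedPotential

section LeviForm

theorem leviForm_congr {χ χ' : ℂ × ℂ → ℝ} {p : ℂ × ℂ} (h : χ =ᶠ[𝓝 p] χ') (b : ℂ × ℂ) :
    leviForm χ p b = leviForm χ' p b := by
  have hline : Tendsto (fun ζ : ℂ => p + ζ • b) (𝓝 0) (𝓝 p) :=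
    Continuous.tendsto' (by fun_prop) 0 p (by simp)
  have hcomp : (fun ζ : ℂ => χ (p + ζ • b)) =ᶠ[𝓝 0] fun ζ => χ' (p + ζ • b) := h.comp_tendsto hline
  rw [leviForm, leviForm, (InnerProductSpace.laplacian_congr_nhds hcomp).eq_of_nhds]

theorem leviForm_const (a : ℝ) (p b : ℂ × ℂ) : leviForm (fun _ => a) p b = 0 := by
  rw [leviForm, InnerProductSpace.laplacian_const, Pi.zero_apply]

theorem leviForm_eq_zero_of_notMem_tsupport {χ : ℂ × ℂ → ℝ} {p : ℂ × ℂ} (hp : p ∉ tsupport χ)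
    (b : ℂ × ℂ) : leviForm χ p b = 0 :=
  (leviForm_congr (notMem_tsupport_iff_eventuallyEq.1 hp) b).trans (leviForm_const 0 p b)

theorem leviForm_eq_fderiv {χ : ℂ × ℂ → ℝ} {p : ℂ × ℂ} (hχ : ContDiffAt ℝ 2 χ p) (b : ℂ × ℂ) :
    leviForm χ p b = fderiv ℝ (fun q => fderiv ℝ χ q b) p b
      + fderiv ℝ (fun q => fderiv ℝ χ q (Complex.I • b)) p (Complex.I • b) := by
  let L : ℂ →L[ℝ] ℂ × ℂ := (ContinuousLinearMap.id ℝ ℂ).smulRight b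
  have hline : fderiv ℝ (fun ζ : ℂ => p + ζ • b) = fun _ => L :=
    funext fun ζ => (L.hasFDerivAt.const_add p).fderiv
  have hp : p + (0 : ℂ) • b = p := by simp
  have hcomp (v : ℂ) : fderiv ℝ (fderiv ℝ fun ζ : ℂ => χ (p + ζ • b)) 0 v v
      = fderiv ℝ (fun q => fderiv ℝ χ q (v • b)) p (v • b) := by
    have h := fderiv_fderiv_comp (f := fun ζ : ℂ => p + ζ • b) (x := 0) (hp.symm ▸ hχ)
      (by fun_prop) v v
    rw [hline, hp, fderiv_fun_const, Pi.zero_apply, zero_apply, zero_apply, map_zero,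
      add_zero] at h
    rw [fderiv_fderiv_apply hχ]
    exact h
  rw [leviForm, laplacian_eq_fderiv, hcomp, hcomp, one_smul]

theorem integrable_mul_of_continuousAt {E : Type*} [TopologicalSpace E] [MeasurableSpace E]
    [OpensMeasurableSpace E] {μ : Measure E}
    [IsFiniteMeasureOnCompacts μ] {f g : E → ℝ}
    (hf : ∀ x ∈ tsupport g, ContinuousAt f x) (hg : Continuous g) (hs : HasCompactSupport g) :
    Integrable (fun x => f x * g x) μ :=
  (continuous_of_tsupport fun x hx =>
    (hf x (tsupport_mul_subset_right hx)).mul hg.continuousAt).integrable_of_hasCompactSupport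
    hs.mul_left

section IntegrationByParts

variable {E : Type*} [NormedAddCommGroup E] [NormedSpace ℝ E]

theorem tsupport_fderiv_fderiv_apply_subset (χ : E → ℝ) (v : E) :
    tsupport (fun p => fderiv ℝ (fun q => fderiv ℝ χ q v) p v) ⊆ tsupport χ :=
  (tsupport_fderiv_apply_subset ℝ v).trans (tsupport_fderiv_apply_subset ℝ v)

theorem continuous_fderiv_fderiv_apply {χ : E → ℝ} (hχ : ContDiff ℝ 2 χ) (v : E) :
    Continuous fun p => fderiv ℝ (fun q => fderiv ℝ χ q v) p v :=
  ((contDiff_fderiv_apply hχ v).continuous_fderiv one_ne_zero).clm_apply continuous_const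

theorem integral_mul_fderiv_fderiv_apply [FiniteDimensional ℝ E] [MeasurableSpace E] [BorelSpace E]
    {μ : Measure E} [μ.IsAddHaarMeasure] {f χ : E → ℝ}
    (hf : ∀ p ∈ tsupport χ, ContDiffAt ℝ 2 f p) (hχ : ContDiff ℝ 2 χ) (hs : HasCompactSupport χ)
    (v : E) :
    ∫ p, f p * fderiv ℝ (fun q => fderiv ℝ χ q v) p v ∂μ
      = ∫ p, fderiv ℝ (fun q => fderiv ℝ f q v) p v * χ p ∂μ := by
  have hs₁ : HasCompactSupport fun p => fderiv ℝ χ p v := hs.fderiv_apply (𝕜 := ℝ) v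
  have hsub₁ : tsupport (fun p => fderiv ℝ χ p v) ⊆ tsupport χ := tsupport_fderiv_apply_subset ℝ v
  have hχ₁ := contDiff_fderiv_apply hχ v
  have hf₁ (p) (hp : p ∈ tsupport χ) : ContDiffAt ℝ 1 (fun q => fderiv ℝ f q v) p :=
    ((hf p hp).fderiv_right (m := 1) (by norm_num)).clm_apply contDiffAt_const
  have hf₂ (p) (hp : p ∈ tsupport χ) :
      ContinuousAt (fun p => fderiv ℝ (fun q => fderiv ℝ f q v) p v) p :=
    ((hf₁ p hp).fderiv_right (m := 0) (by norm_num)).continuousAt.clm_apply continuousAt_const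
  have hint₁ := integrable_mul_of_continuousAt (μ := μ)
    (fun p hp => (hf₁ p (hsub₁ hp)).continuousAt) hχ₁.continuous hs₁
  rw [integral_mul_fderiv_eq_neg_fderiv_mul_of_integrable hint₁
    (integrable_mul_of_continuousAt
      (fun p hp => (hf p (tsupport_fderiv_fderiv_apply_subset χ v hp)).continuousAt)
      (continuous_fderiv_fderiv_apply hχ v) (hs₁.fderiv_apply (𝕜 := ℝ) v))
    (integrable_mul_of_continuousAt (fun p hp => (hf p (hsub₁ hp)).continuousAt)
      hχ₁.continuous hs₁)
    (fun p hp => (hf p (hsub₁ hp)).differentiableAt two_ne_zero)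
    (fun p _ => hχ₁.differentiable one_ne_zero p),
    integral_mul_fderiv_eq_neg_fderiv_mul_of_integrable
    (integrable_mul_of_continuousAt hf₂ hχ.continuous hs) hint₁
    (integrable_mul_of_continuousAt (fun p hp => (hf₁ p hp).continuousAt) hχ.continuous hs)
    (fun p hp => (hf₁ p hp).differentiableAt one_ne_zero)
    (fun p _ => hχ.differentiable two_ne_zero p), neg_neg]

end IntegrationByParts

variable {χ : ℂ × ℂ → ℝ} {U : Set (ℂ × ℂ)}

theorem continuous_leviForm (hχ : ContDiff ℝ 2 χ) (b : ℂ × ℂ) :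
    Continuous fun q => leviForm χ q b := by
  simp only [leviForm_eq_fderiv hχ.contDiffAt]
  exact (continuous_fderiv_fderiv_apply hχ b).add (continuous_fderiv_fderiv_apply hχ _)

theorem integral_mul_leviForm_eq_zero {f : ℂ × ℂ → ℝ} {b : ℂ × ℂ}
    (hf : ∀ q ∈ tsupport χ, ContDiffAt ℝ 2 f q) (hf0 : ∀ q ∈ tsupport χ, leviForm f q b = 0)
    (hχ : ContDiff ℝ 2 χ) (hs : HasCompactSupport χ) : ∫ q, f q * leviForm χ q b = 0 := by
  have : (volume : Measure (ℂ × ℂ)).IsAddHaarMeasure :=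
    inferInstanceAs ((volume : Measure ℂ).prod volume).IsAddHaarMeasure
  have hint₁ (v : ℂ × ℂ) := integrable_mul_of_continuousAt (μ := volume)
    (fun p hp => (hf p (tsupport_fderiv_fderiv_apply_subset χ v hp)).continuousAt)
    (continuous_fderiv_fderiv_apply hχ v)
    ((hs.fderiv_apply (𝕜 := ℝ) v).fderiv_apply (𝕜 := ℝ) v)
  have hf₁ (v q : ℂ × ℂ) (hq : q ∈ tsupport χ) : ContDiffAt ℝ 1 (fun p => fderiv ℝ f p v) q :=
    ((hf q hq).fderiv_right (m := 1) (by norm_num)).clm_apply contDiffAt_const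
  have hint₂ (v : ℂ × ℂ) := integrable_mul_of_continuousAt (μ := volume)
    (f := fun p => fderiv ℝ (fun q => fderiv ℝ f q v) p v)
    (fun q hq => ((hf₁ v q hq).fderiv_right (m := 0) (by norm_num)).continuousAt.clm_apply
      continuousAt_const) hχ.continuous hs
  simp only [leviForm_eq_fderiv hχ.contDiffAt, mul_add]
  rw [integral_add (hint₁ _) (hint₁ _), integral_mul_fderiv_fderiv_apply hf hχ hs,
    integral_mul_fderiv_fderiv_apply hf hχ hs, ← integral_add (hint₂ _) (hint₂ _)]
  refine integral_eq_zero_of_ae (Eventually.of_forall fun q => ?_)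
  simp only [Pi.zero_apply, ← add_mul]
  by_cases hq : q ∈ tsupport χ
  · rw [← leviForm_eq_fderiv (hf q hq), hf0 q hq, zero_mul]
  · rw [image_eq_zero_of_notMem_tsupport hq, mul_zero]

theorem integrable_mul_leviForm {u : ℂ × ℂ → ℝ} (hu : LocallyIntegrableOn u U)
    (hχ : ContDiff ℝ 2 χ) (hs : HasCompactSupport χ) (hsub : tsupport χ ⊆ U) (b : ℂ × ℂ) :
    Integrable fun q => u q * leviForm χ q b := by
  rw [← integrableOn_iff_integrable_of_support_subset (s := tsupport χ)]
  · exact (hu.integrableOn_compact_subset hsub hs).mul_continuousOn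
      (continuous_leviForm hχ b).continuousOn hs
  · refine fun q hq => by_contra fun hqχ => hq ?_
    simp only [leviForm_eq_zero_of_notMem_tsupport hqχ, mul_zero]

theorem integral_sub_const_mul_leviForm {u : ℂ × ℂ → ℝ}
    (hu : LocallyIntegrableOn u U) (hχ : ContDiff ℝ 2 χ) (hs : HasCompactSupport χ)
    (hsub : tsupport χ ⊆ U) (a : ℝ) (b : ℂ × ℂ) :
    ∫ q, (u q - a) * leviForm χ q b = ∫ q, u q * leviForm χ q b := by
  simp only [sub_mul]
  rw [integral_sub (integrable_mul_leviForm hu hχ hs hsub b)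
    (integrable_mul_leviForm (continuous_const.locallyIntegrable.locallyIntegrableOn Set.univ) hχ hs
      (Set.subset_univ _) b), integral_mul_leviForm_eq_zero (fun _ _ => contDiffAt_const)
      (fun q _ => leviForm_const a q b) hχ hs, sub_zero]

end LeviForm

section CurrentVanishes

theorem isOpen_setOf_chart_mem {c : ℂ → P1} (hc : c ∈ charts) {S : Set (P1 × ℂ)} (hS : IsOpen S) :
    IsOpen {q : ℂ × ℂ | (c q.1, q.2) ∈ S} :=
  hS.preimage (((isOpenEmbedding_chart hc).continuous.comp continuous_fst).prodMk continuous_snd)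

theorem currentVanishesOn_of_pluriharmonic {Φ : P1 × ℂ → ℝ} {S : Set (P1 × ℂ)} (hS : IsOpen S)
    (h : ∀ c ∈ charts, ∀ q : ℂ × ℂ, (c q.1, q.2) ∈ S →
      ContDiffAt ℝ 2 (fun q : ℂ × ℂ => fsPotential q.1 + Φ (c q.1, q.2)) q ∧
      ∀ b, leviForm (fun q : ℂ × ℂ => fsPotential q.1 + Φ (c q.1, q.2)) q b = 0) :
    CurrentVanishesOn Φ S := fun c hc =>
  ⟨ContinuousOn.locallyIntegrableOn
      (fun q hq => (h c hc q hq).1.continuousAt.continuousWithinAt)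
      (isOpen_setOf_chart_mem hc hS).measurableSet,
    fun _ hχ hs hsub b => integral_mul_leviForm_eq_zero (fun q hq => (h c hc q (hsub hq)).1)
      (fun q hq => (h c hc q (hsub hq)).2 b) (hχ.of_le (WithTop.coe_le_coe.2 le_top)) hs⟩

theorem ne_zero_of_chartW_eq_chartZ {w z : ℂ} (h : chartW w = chartZ z) : z ≠ 0 ∧ w = z⁻¹ := by
  rcases eq_or_ne w 0 with rfl | hw
  · rw [chartW_zero] at h
    exact absurd h (OnePoint.infty_ne_coe z)
  · rw [chartW_of_ne hw] at h
    rw [← OnePoint.coe_injective h, inv_inv]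
    exact ⟨inv_ne_zero hw, rfl⟩

theorem leviForm_log_norm_fst {q : ℂ × ℂ} (hq : q.1 ≠ 0) (a : ℝ) :
    ContDiffAt ℝ 2 (fun q : ℂ × ℂ => 2 * Real.log ‖q.1‖ + a) q ∧
      ∀ b, leviForm (fun q : ℂ × ℂ => 2 * Real.log ‖q.1‖ + a) q b = 0 := by
  obtain ⟨hC, hΔ⟩ := laplacian_const_mul_log_norm hq 2
  refine ⟨(hC.comp q contDiffAt_fst).add contDiffAt_const, fun b => ?_⟩
  have hline : AnalyticAt ℂ (fun ζ : ℂ => q.1 + ζ * b.1) 0 := by fun_prop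
  have hq0 : q.1 + 0 * b.1 = q.1 := by ring
  have h := laplacian_comp_analytic (g := fun z : ℂ => 2 * Real.log ‖z‖ + a) hline
    (by rw [hq0]; exact hC.add contDiffAt_const)
  rw [hq0, laplacian_add_const hC, hΔ, mul_zero] at h
  exact h

theorem currentVanishesOn_image_chartW {Φ : P1 × ℂ → ℝ} {U V : Set ℂ} (hU : IsOpen U)
    (hV : IsOpen V) {a : ℝ} (h : ∀ w ∈ U, ∀ τ ∈ V, fsPotential w + Φ (chartW w, τ) = a) :
    CurrentVanishesOn Φ ((chartW '' U) ×ˢ V) := by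
  have hW := isOpenEmbedding_chart (c := chartW) (by simp [charts])
  have hS : IsOpen ((chartW '' U) ×ˢ V) := (hW.isOpenMap U hU).prod hV
  refine currentVanishesOn_of_pluriharmonic hS fun c hc q hq => ?_
  suffices hlocal : ∃ f : ℂ × ℂ → ℝ, (ContDiffAt ℝ 2 f q ∧ ∀ b, leviForm f q b = 0) ∧
      ∀ p : ℂ × ℂ, (c p.1, p.2) ∈ (chartW '' U) ×ˢ V → fsPotential p.1 + Φ (c p.1, p.2) = f p by
    obtain ⟨f, ⟨hf, hf0⟩, hfΦ⟩ := hlocal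
    have heq := mem_of_superset ((isOpen_setOf_chart_mem hc hS).mem_nhds hq) hfΦ
    exact ⟨hf.congr_of_eventuallyEq heq, fun b => (leviForm_congr heq b).trans (hf0 b)⟩
  rcases hc with rfl | rfl
  · obtain ⟨⟨w, -, hwq⟩, -⟩ := hq
    refine ⟨_, leviForm_log_norm_fst (ne_zero_of_chartW_eq_chartZ hwq).1 a, fun p hp => ?_⟩
    obtain ⟨⟨w, hw, hwp⟩, hτ⟩ := hp
    have hwΦ := h w hw p.2 hτ
    rw [hwp] at hwΦ
    obtain ⟨hp0, rfl⟩ := ne_zero_of_chartW_eq_chartZ hwp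
    rw [fsPotential_inv hp0] at hwΦ
    linarith
  · refine ⟨fun _ => a, ⟨contDiffAt_const, leviForm_const a q⟩, fun p hp => ?_⟩
    exact h p.1 ((hW.injective.mem_set_image).1 hp.1) p.2 hp.2

end CurrentVanishes

section RadialBump

theorem deriv_expNegInvGlue : deriv expNegInvGlue = fun y => y⁻¹ ^ 2 * expNegInvGlue y := by
  ext y
  simpa using (expNegInvGlue.hasDerivAt_polynomial_eval_inv_mul 1 y).deriv

theorem deriv_deriv_expNegInvGlue (y : ℝ) :
    deriv (deriv expNegInvGlue) y = (y⁻¹ ^ 4 - 2 * y⁻¹ ^ 3) * expNegInvGlue y := by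
  have h := (expNegInvGlue.hasDerivAt_polynomial_eval_inv_mul (Polynomial.X ^ 2) y).deriv
  simp only [Polynomial.eval_pow, Polynomial.eval_X, Polynomial.eval_mul, Polynomial.eval_sub,
    Polynomial.derivative_X_pow, Polynomial.eval_C] at h
  rw [deriv_expNegInvGlue, h]
  push_cast
  ring

/-- A smooth bump function supported in the disc `‖w‖ ^ 2 ≤ P`; it is subharmonic where
`k * P ^ 2 ≤ ‖w‖ ^ 2`, so for small `k` outside a small disc. -/
noncomputable def radialBump (k P : ℝ) (w : ℂ) : ℝ := expNegInvGlue (k * (P - ‖w‖ ^ 2))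

variable {k P : ℝ} {w : ℂ}

theorem contDiff_radialBump {n : ℕ∞} : ContDiff ℝ n (radialBump k P) :=
  expNegInvGlue.contDiff.comp (contDiff_const.mul (contDiff_const.sub (contDiff_norm_sq ℝ)))

theorem radialBump_eq_zero (hk : 0 ≤ k) (hw : P ≤ ‖w‖ ^ 2) : radialBump k P w = 0 :=
  expNegInvGlue.zero_of_nonpos (mul_nonpos_of_nonneg_of_nonpos hk (sub_nonpos.2 hw))

theorem laplacian_radialBump : Δ (radialBump k P) w =
    4 * k * (k * ‖w‖ ^ 2 * deriv (deriv expNegInvGlue) (k * (P - ‖w‖ ^ 2))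
      - deriv expNegInvGlue (k * (P - ‖w‖ ^ 2))) := by
  have hinner (s : ℝ) : HasDerivAt (fun s => k * (P - s)) (-k) s := by
    simpa using ((hasDerivAt_id s).const_sub P).const_mul k
  have hC : ContDiff ℝ 2 expNegInvGlue := expNegInvGlue.contDiff
  have hC' : ContDiff ℝ 1 (deriv expNegInvGlue) := ((contDiff_succ_iff_deriv (n := 1)).1 hC).2.2
  have hD : deriv (fun s => expNegInvGlue (k * (P - s)))
      = fun s => deriv expNegInvGlue (k * (P - s)) * -k := funext fun s =>
    ((hC.differentiable two_ne_zero _).hasDerivAt.comp s (hinner s)).deriv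
  have hD₂ (s : ℝ) : deriv (fun s => deriv expNegInvGlue (k * (P - s)) * -k) s
      = deriv (deriv expNegInvGlue) (k * (P - s)) * -k * -k :=
    (((hC'.differentiable one_ne_zero _).hasDerivAt.comp s (hinner s)).mul_const (-k)).deriv
  have h := laplacian_comp_norm_sq (z := w) (f := fun s => expNegInvGlue (k * (P - s)))
    (hC.comp (contDiff_const.mul (contDiff_const.sub contDiff_id))).contDiffAt
  rw [hD, hD₂] at h
  exact h.trans (by ring)

theorem laplacian_radialBump_pos (hk : 0 < k) (hP : k * P ^ 2 ≤ ‖w‖ ^ 2) (hw : ‖w‖ ^ 2 < P) :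
    0 < Δ (radialBump k P) w := by
  have hs := sq_nonneg ‖w‖
  rw [laplacian_radialBump, deriv_deriv_expNegInvGlue, deriv_expNegInvGlue]
  set s := ‖w‖ ^ 2
  have hy : 0 < k * (P - s) := mul_pos hk (sub_pos.2 hw)
  have hφ := expNegInvGlue.pos_of_pos hy
  have hkP : 0 < k * P ^ 2 := mul_pos hk (pow_pos (hs.trans_lt hw) 2)
  have hbracket : 0 < s - k * (P ^ 2 - s ^ 2) := by
    linarith [mul_pos hk (pow_pos (hkP.trans_le hP) 2)]
  have heq : 4 * k * (k * s * (((k * (P - s))⁻¹ ^ 4 - 2 * (k * (P - s))⁻¹ ^ 3)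
        * expNegInvGlue (k * (P - s))) - (k * (P - s))⁻¹ ^ 2 * expNegInvGlue (k * (P - s)))
      = 4 * k ^ 2 * (k * (P - s))⁻¹ ^ 4 * expNegInvGlue (k * (P - s))
        * (s - k * (P ^ 2 - s ^ 2)) := by
    have hne : P - s ≠ 0 := (sub_pos.2 hw).ne'
    field_simp
    ring
  rw [heq]
  positivity

theorem laplacian_radialBump_nonneg (hk : 0 < k) (hP : k * P ^ 2 ≤ ‖w‖ ^ 2) :
    0 ≤ Δ (radialBump k P) w := by
  rcases lt_or_ge (‖w‖ ^ 2) P with hw | hw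
  · exact (laplacian_radialBump_pos hk hP hw).le
  · have hφ := expNegInvGlue.zero_of_nonpos
      (mul_nonpos_of_nonneg_of_nonpos hk.le (sub_nonpos.2 hw))
    rw [laplacian_radialBump, deriv_deriv_expNegInvGlue, deriv_expNegInvGlue]
    simp only [hφ, mul_zero, sub_zero, le_refl]

end RadialBump

section Detection

theorem leviForm_mul_fst {η β : ℂ → ℝ} {q : ℂ × ℂ} (hη : ContDiffAt ℝ 2 η q.1) :
    leviForm (fun q : ℂ × ℂ => η q.1 * β q.2) q (1, 0) = β q.2 * Δ η q.1 := by
  have hline : AnalyticAt ℂ (fun ζ : ℂ => q.1 + ζ) 0 := by fun_prop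
  have h := laplacian_comp_analytic (g := β q.2 • η) hline
    (by rw [add_zero]; exact hη.const_smul (β q.2))
  rw [deriv_const_add, deriv_id'', norm_one, one_pow, one_mul, add_zero,
    InnerProductSpace.laplacian_smul _ hη] at h
  rw [leviForm, ← smul_eq_mul, ← h]
  refine congrArg (fun f : ℂ → ℝ => Δ f 0) (funext fun ζ => ?_)
  simp [mul_comm]

theorem tsupport_radialBump_mul_subset {k P : ℝ} (hk : 0 ≤ k) (β : ContDiffBump (0 : ℂ)) :
    tsupport (fun q : ℂ × ℂ => radialBump k P q.1 * β q.2)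
      ⊆ closedBall 0 (√P) ×ˢ closedBall 0 β.rOut := by
  refine closure_minimal (fun q hq => ⟨?_, ?_⟩) (isClosed_closedBall.prod isClosed_closedBall)
  · by_contra hw
    rw [mem_closedBall_zero_iff, not_le] at hw
    exact left_ne_zero_of_mul hq (radialBump_eq_zero hk (Real.lt_sq_of_sqrt_lt hw).le)
  · exact ball_subset_closedBall (β.support_eq.subset (right_ne_zero_of_mul hq))

theorem exists_testFunction {r R δ : ℝ} (hr : 0 < r) (hδ : 0 < δ) :
    ∃ χ : ℂ × ℂ → ℝ, ContDiff ℝ ∞ χ ∧ HasCompactSupport χ ∧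
      tsupport χ ⊆ Set.univ ×ˢ ball 0 δ ∧
      (∀ q : ℂ × ℂ, r ≤ ‖q.1‖ → 0 ≤ leviForm χ q (1, 0)) ∧
      ∃ q : ℂ × ℂ, R < ‖q.1‖ ∧ 0 < leviForm χ q (1, 0) := by
  let P : ℝ := R ^ 2 + r ^ 2 + 1
  let k : ℝ := r ^ 2 / P ^ 2
  have hP : 0 < P := by positivity
  have hk : 0 < k := div_pos (pow_pos hr 2) (pow_pos hP 2)
  have hkP : k * P ^ 2 = r ^ 2 := div_mul_cancel₀ _ (pow_pos hP 2).ne'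
  let β : ContDiffBump (0 : ℂ) := ⟨δ / 3, δ / 2, by positivity, by linarith⟩
  have hsub := tsupport_radialBump_mul_subset (P := P) hk.le β
  have hlevi (q : ℂ × ℂ) := leviForm_mul_fst (β := β) (q := q)
    (contDiff_radialBump (k := k) (P := P) (n := 2)).contDiffAt
  refine ⟨fun q => radialBump k P q.1 * β q.2, ?_, ?_, ?_, fun q hq => ?_, ?_⟩
  · exact (contDiff_radialBump.comp contDiff_fst).mul (β.contDiff.comp contDiff_snd)
  · exact ((isCompact_closedBall _ _).prod (isCompact_closedBall _ _)).of_isClosed_subset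
      (isClosed_tsupport _) hsub
  · exact hsub.trans (Set.prod_mono (Set.subset_univ _) (closedBall_subset_ball (half_lt_self hδ)))
  · rw [hlevi]
    exact mul_nonneg β.nonneg (laplacian_radialBump_nonneg hk (hkP.trans_le (by gcongr)))
  · have hw : ‖((√(R ^ 2 + r ^ 2) : ℝ) : ℂ)‖ ^ 2 = R ^ 2 + r ^ 2 := by
      rw [Complex.norm_of_nonneg (Real.sqrt_nonneg _), Real.sq_sqrt (by positivity)]
    refine ⟨((√(R ^ 2 + r ^ 2) : ℝ), 0), lt_of_pow_lt_pow_left₀ 2 (norm_nonneg _) ?_, ?_⟩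
    · rw [hw]
      exact lt_add_of_pos_right _ (by positivity)
    · rw [hlevi]
      refine mul_pos (β.pos_of_mem_ball (mem_ball_self β.rOut_pos))
        (laplacian_radialBump_pos hk ?_ ?_)
      · rw [hw, hkP]
        exact le_add_of_nonneg_left (sq_nonneg R)
      · rw [hw]
        exact lt_add_one _

theorem exists_integral_mul_leviForm_pos {u : ℂ × ℂ → ℝ} {r R δ a : ℝ} (hr : 0 < r) (hδ : 0 < δ)
    (hu : LocallyIntegrableOn u (Set.univ ×ˢ ball 0 δ))
    (hle : ∀ q : ℂ × ℂ, ‖q.2‖ < δ → a ≤ u q)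
    (heq : ∀ q : ℂ × ℂ, ‖q.2‖ < δ → ‖q.1‖ ≤ r → u q = a)
    (hlt : ∀ q : ℂ × ℂ, ‖q.2‖ < δ → R < ‖q.1‖ → a < u q) :
    ∃ χ : ℂ × ℂ → ℝ, ContDiff ℝ ∞ χ ∧ HasCompactSupport χ ∧
      tsupport χ ⊆ Set.univ ×ˢ ball 0 δ ∧ 0 < ∫ q, u q * leviForm χ q (1, 0) := by
  obtain ⟨χ, hχ, hs, hsub, hnonneg, p, hp, hpos⟩ := exists_testFunction (R := R) hr hδ
  refine ⟨χ, hχ, hs, hsub, ?_⟩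
  have hχ₂ : ContDiff ℝ 2 χ := hχ.of_le (WithTop.coe_le_coe.2 le_top)
  have hmem {q : ℂ × ℂ} (hq : leviForm χ q (1, 0) ≠ 0) : ‖q.2‖ < δ :=
    mem_ball_zero_iff.1 (hsub (not_not.1 fun h =>
      hq (leviForm_eq_zero_of_notMem_tsupport h _))).2
  have hint : Integrable fun q => (u q - a) * leviForm χ q (1, 0) :=
    integrable_mul_leviForm (hu.sub (continuous_const.locallyIntegrable.locallyIntegrableOn _))
      hχ₂ hs hsub _
  rw [← integral_sub_const_mul_leviForm hu hχ₂ hs hsub a,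
    integral_pos_iff_support_of_nonneg (fun q => ?_) hint]
  · have hopen : IsOpen {q : ℂ × ℂ | R < ‖q.1‖ ∧ 0 < leviForm χ q (1, 0)} :=
      (isOpen_lt continuous_const continuous_fst.norm).inter
        (isOpen_lt continuous_const (continuous_leviForm hχ₂ _))
    refine (hopen.measure_pos volume ⟨p, hp, hpos⟩).trans_le (measure_mono fun q hq => ?_)
    exact (mul_pos (sub_pos.2 (hlt q (hmem hq.2.ne') hq.1)) hq.2).ne'
  · change 0 ≤ (u q - a) * leviForm χ q (1, 0)
    by_cases hq : leviForm χ q (1, 0) = 0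
    · rw [hq, mul_zero]
    rcases le_total r ‖q.1‖ with hqr | hqr
    · exact mul_nonneg (sub_nonneg.2 (hle q (hmem hq))) (hnonneg q hqr)
    · rw [heq q (hmem hq) hqr, sub_self, zero_mul]

theorem not_isStrictlyPositive {f : P1 → ℝ} {r a : ℝ} (hr : 0 < r)
    (h : ∀ w : ℂ, ‖w‖ ≤ r → fsPotential w + f (chartW w) = a) : ¬ IsStrictlyPositive f := by
  rintro ⟨ε, hε, hpsh⟩
  have hcircle (ζ : ℂ) (hζ : ζ ∈ sphere (0 : ℂ) 1) :
      (((1 - ε) * fsPotential (0 + ζ • (r : ℂ)) + f (chartW (0 + ζ • (r : ℂ))) : ℝ) : EReal)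
        ≤ ((a - ε * Real.log (1 + r ^ 2) : ℝ) : EReal) := by
    have hnorm : ‖0 + ζ • (r : ℂ)‖ = r := by
      rw [zero_add, norm_smul, mem_sphere_zero_iff_norm.1 hζ, one_mul,
        Complex.norm_of_nonneg hr.le]
    have hfs : fsPotential (0 + ζ • (r : ℂ)) = Real.log (1 + r ^ 2) := by
      rw [fsPotential, hnorm]
    rw [EReal.coe_le_coe_iff, ← hfs, ← h _ hnorm.le]
    linarith
  have hmean := (hpsh chartW (by simp [charts])).2.2 0 (r : ℂ) (fun _ _ => Set.mem_univ _)
    (fun _ => a - ε * Real.log (1 + r ^ 2)) continuousOn_const hcircle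
  have hcenter := h 0 (by simpa using hr.le)
  have hfs0 : fsPotential 0 = 0 := by simp [fsPotential]
  rw [Real.circleAverage_const, EReal.coe_le_coe_iff, hfs0] at hmean
  have hlog : 0 < Real.log (1 + r ^ 2) := Real.log_pos (lt_add_of_pos_right 1 (by positivity))
  linarith [mul_pos hε hlog]

end Detection

section Degeneracy

variable {Φ : P1 × ℂ → ℝ}

theorem not_currentVanishesOn_openProduct (hΦ : IsWeakSolution rotatedPotential Φ) :
    ¬ CurrentVanishesOn Φ openProduct := by
  intro hvanish
  obtain ⟨hloc, hzero⟩ := hvanish chartW (by simp [charts])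
  have hset : {q : ℂ × ℂ | (chartW q.1, q.2) ∈ openProduct} = Set.univ ×ˢ ball 0 1 := by
    ext q
    simp [openProduct]
  rw [hset] at hloc hzero
  have hball : (Set.univ : Set ℂ) ×ˢ ball (0 : ℂ) (1 / 2) ⊆ Set.univ ×ˢ ball 0 1 :=
    Set.prod_mono_right (ball_subset_ball (by norm_num))
  have hlower (q : ℂ × ℂ) (hq : ‖q.2‖ < 1 / 2) :=
    flatValue_add_softPosPart_le (w := q.1) hΦ (hq.le.trans (by norm_num))
  obtain ⟨χ, hχ, hs, hsub, hpos⟩ := exists_integral_mul_leviForm_pos (r := 3 / 8) (R := 3)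
    (a := flatValue) (by norm_num) (by norm_num) (hloc.mono_set hball)
    (fun q hq => (le_add_of_nonneg_right (softPosPart_nonneg _)).trans (hlower q hq))
    (fun q hq hw => eq_flatValue hΦ (hq.trans (by norm_num)) (by
      nlinarith [norm_nonneg q.2]))
    (fun q hq hw => by
      have hlog : Real.log 6 < fsPotential q.1 :=
        Real.log_lt_log (by norm_num) (by nlinarith)
      have hflat : flatValue ≤ Real.log 6 := sub_le_self _ softPosPartGap_nonneg
      have := softPosPart_pos (sub_pos.2 (hflat.trans_lt hlog))
      linarith [hlower q hq])
  exact hpos.ne' (hzero χ hχ hs (hsub.trans hball) (1, 0))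

end Degeneracy

end HMAE

/-- There is a smooth family of Kähler potentials on `(P1, ω_FS)`, indexed by the unit circle, whose
solution `Φ` of the homogeneous complex Monge-Ampère equation satisfies `π^* ω_FS + dd^c Φ = 0` on
some non-empty open `S`. Its rank is not maximal, and (`π^* ω_FS + dd^c Φ` being zero on `S` but
not identically zero) not constant. -/
theorem theorem1p1 :
    ∃ φ : Circle → HMAE.P1 → ℝ,
      HMAE.IsSmoothFamily φ ∧ (∀ τ : Circle, HMAE.IsKahlerPotential (φ τ)) ∧
      ∃ Φ : HMAE.P1 × ℂ → ℝ, HMAE.IsWeakSolution φ Φ ∧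
        (∃ S : Set (HMAE.P1 × ℂ), IsOpen S ∧ S.Nonempty ∧ S ⊆ HMAE.openProduct ∧
          HMAE.CurrentVanishesOn Φ S) ∧
        ¬ HMAE.HasMaximalRank Φ ∧
        ¬ HMAE.CurrentVanishesOn Φ HMAE.openProduct := by
  obtain ⟨Φ, hΦ⟩ := HMAE.exists_isWeakSolution
    HMAE.isSmoothFamily_rotatedPotential.continuous HMAE.isKahlerPotential_rotatedPotential
  have hflat (w : ℂ) (hw : w ∈ Metric.ball 0 (3 / 8)) (τ : ℂ) (hτ : τ ∈ Metric.ball 0 (1 / 2)) :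
      HMAE.fsPotential w + Φ (HMAE.chartW w, τ) = HMAE.flatValue := by
    rw [mem_ball_zero_iff] at hw hτ
    exact HMAE.eq_flatValue hΦ (by linarith) (by nlinarith [norm_nonneg τ])
  refine ⟨HMAE.rotatedPotential, HMAE.isSmoothFamily_rotatedPotential,
    HMAE.isKahlerPotential_rotatedPotential, Φ, hΦ,
    ⟨(HMAE.chartW '' Metric.ball 0 (3 / 8)) ×ˢ Metric.ball 0 (1 / 2), ?_, ?_, ?_,
      HMAE.currentVanishesOn_image_chartW Metric.isOpen_ball Metric.isOpen_ball hflat⟩,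
    fun hmax => ?_, HMAE.not_currentVanishesOn_openProduct hΦ⟩
  · exact ((HMAE.isOpenEmbedding_chart (by simp [HMAE.charts])).isOpenMap _
      Metric.isOpen_ball).prod Metric.isOpen_ball
  · exact ((Metric.nonempty_ball.2 (by norm_num)).image _).prod
      (Metric.nonempty_ball.2 (by norm_num))
  · exact Set.prod_mono (Set.subset_univ _) (Metric.ball_subset_ball (by norm_num))
  · exact HMAE.not_isStrictlyPositive (r := 1 / 4) (by norm_num)
      (fun w hw => hflat w (mem_ball_zero_iff.2 (by linarith)) 0 (by simp))
      (hmax 0 (by simp))
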